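/- Let $N\ge 1$, $d>0$ and $b>0$ with $\sqrt b\neq \pi j/(2d)$ for $j=1,2,\dots$. For a smooth function $\omega:\mathbb R\to\mathbb R$, a stream solution of depth $d$ is a function $u$ on $[0,d]$ with $u''+\omega(u)=0$, $u(0)=0$, $u(d)=1$. If $u'(d)\ne0$, the Sturm--Liouville problem of the triple $(\omega,d,u)$ is $$-\varphi''-\omega'(u)\varphi=\mu\varphi\ \text{ on }(0,d),\qquad \varphi(0)=0,\qquad \varphi'(d)=\kappa\varphi(d),\qquad \kappa=\frac1{u'(d)^2}-\frac{\omega(1)}{u'(d)}.$$ Let $\omega_0(p)=bp$, let $u_0$ be its stream solution of depth $d$, and assume that the Sturm--Liouville problem of $(\omega_0,d,u_0)$ has exactly $N$ negative eigenvalues and that all its other eigenvalues are positive. Then there exist $\omega_1,\dots,\omega_N\in C_0^\infty(0,1)$ (extended by zero to $\mathbb R$) with the following property. Put $\omega_\delta(p)=bp+\delta_1\omega_1(p)+\dots+\delta_N\omega_N(p)$ for $\delta\in\mathbb R^N$. For all sufficiently small $\delta$ there is a unique stream solution $u_\delta$ of depth $d$ for $\omega_\delta$, it satisfies $u_\delta'(d)\neq0$,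 and the Sturm--Liouville problem of $(\omega_\delta,d,u_\delta)$ has exactly $N$ negative eigenvalues $\mu_1(\delta)<\dots<\mu_N(\delta)$. The map $T:\delta\mapsto\mu=(\mu_1,\dots,\mu_N)$ is $C^\infty$ near $\delta=0$, its Jacobian matrix at $\delta=0$ is invertible, and $T$ is a local $C^\infty$-diffeomorphism at $\delta=0$. -/

import Mathlib

open Set Filter Topology
open scoped ContDiff Manifold

noncomputable section

/-- Test functions: `f ∈ C₀^∞(0,1)`, regarded as a function on `ℝ` vanishing outside `(0,1)`. -/
def IsTestFunction (f : ℝ → ℝ) : Prop :=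
  ContDiff ℝ ∞ f ∧ HasCompactSupport f ∧ tsupport f ⊆ Ioo 0 1

/-- `(u, d)` is a stream solution for the vorticity `om = ω`:
`u'' + ω(u) = 0` on `[0,d]`, `u(0) = 0`, `u(d) = 1`. The auxiliary function `v` is `u'`. Only the
values of `u` on `[0,d]` matter. -/
def IsStreamSolution (om : ℝ → ℝ) (d : ℝ) (u : ℝ → ℝ) : Prop :=
  (∃ v : ℝ → ℝ, ∀ z ∈ Icc 0 d,
    HasDerivWithinAt u (v z) (Icc 0 d) z ∧
    HasDerivWithinAt v (-om (u z)) (Icc 0 d) z) ∧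
  u 0 = 0 ∧ u d = 1

/-- The (one-sided) slope `u'(d)` of a function on `[0,d]` at the surface. -/
def surfaceSlope (d : ℝ) (u : ℝ → ℝ) : ℝ := derivWithin u (Icc 0 d) d

/-- `κ = 1 / u'(d)² - ω(1) / u'(d)`. -/
def kappa (om : ℝ → ℝ) (d : ℝ) (u : ℝ → ℝ) : ℝ :=
  1 / surfaceSlope d u ^ 2 - om 1 / surfaceSlope d u

/-- `μ` is an eigenvalue of the Sturm–Liouville problem of the triple `(ω, d, u)`:
`-φ'' - ω'(u) φ = μ φ` on `(0,d)`, `φ(0) = 0`, `φ'(d) = κ φ(d)`, with `φ` not identically zero.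
The auxiliary function `ψ` is `φ'`. -/
def IsSLEigenvalue (om : ℝ → ℝ) (d : ℝ) (u : ℝ → ℝ) (μ : ℝ) : Prop :=
  ∃ φ ψ : ℝ → ℝ,
    (∀ z ∈ Icc 0 d,
      HasDerivWithinAt φ (ψ z) (Icc 0 d) z ∧
      HasDerivWithinAt ψ (-(deriv om (u z)) * φ z - μ * φ z) (Icc 0 d) z) ∧
    φ 0 = 0 ∧ ψ d = kappa om d u * φ d ∧ ∃ z ∈ Icc 0 d, φ z ≠ 0

/-- The set of negative eigenvalues of the Sturm–Liouville problem of `(ω, d, u)`. -/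
def negEigenvalues (om : ℝ → ℝ) (d : ℝ) (u : ℝ → ℝ) : Set ℝ :=
  {μ | μ < 0 ∧ IsSLEigenvalue om d u μ}

/-- The linear vorticity `ω₀(p) = b p`. -/
def linVorticity (b : ℝ) : ℝ → ℝ := fun p => b * p

/-- The perturbed vorticity `ω_δ(p) = b p + δ₁ ω₁(p) + ⋯ + δ_N ω_N(p)`. -/
def perturbedVorticity {N : ℕ} (b : ℝ) (w : Fin N → ℝ → ℝ) (δ : Fin N → ℝ) : ℝ → ℝ :=
  fun p => b * p + ∑ k, δ k * w k p

/-- `T` is (near `δ = 0`) the map `δ ↦ μ = (μ₁ < ⋯ < μ_N)`: for all small `δ` the vorticity `ω_δ`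
has a stream solution `u_δ` of depth `d`, unique on `[0,d]`, with `u_δ'(d) ≠ 0`, and the components
of `T δ`, in increasing order, are precisely the negative eigenvalues of the Sturm–Liouville problem
of `(ω_δ, d, u_δ)`. This determines `T` in a neighbourhood of `0`. -/
def IsNegativeSpectrumMap {N : ℕ} (b d : ℝ) (w : Fin N → ℝ → ℝ) (T : (Fin N → ℝ) → Fin N → ℝ) : Prop :=
  ∀ᶠ δ in 𝓝 (0 : Fin N → ℝ), ∃ u : ℝ → ℝ,
    IsStreamSolution (perturbedVorticity b w δ) d u ∧
    (∀ u' : ℝ → ℝ, IsStreamSolution (perturbedVorticity b w δ) d u' → EqOn u' u (Icc 0 d)) ∧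
    surfaceSlope d u ≠ 0 ∧
    StrictMono (T δ) ∧
    range (T δ) = negEigenvalues (perturbedVorticity b w δ) d u

/-- The Jacobian matrix of `T` at `δ`: the entry `(l, j)` is `∂T_l / ∂δ_j`. -/
def jacobianMatrix {N : ℕ} (T : (Fin N → ℝ) → Fin N → ℝ) (δ : Fin N → ℝ) :
    Matrix (Fin N) (Fin N) ℝ :=
  Matrix.of fun l j => fderiv ℝ T δ (Pi.single j 1) l

end

/-! Put s = √b, so that u₀(z) = sin(sz)/sin(sd). Let φ_l solve φ'' + λ_l φ = 0, φ(0) = 0, φ'(0) = 1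
with λ_l = b + μ_l(0) < s².

Smoothness. The stream problem is an integral equation on C([0,d]). Superposition operators are C^∞
there, so the implicit function theorem yields a smooth family u_δ, and a contraction estimate makes
it globally unique (`exists_stream_family`). The eigenvalues are the zeros of the characteristic
function φ'(d) - κφ(d), which is smooth in (δ, μ). At δ = 0 its negative zeros are simple by Green's
identity, 0 is not a zero, and an energy estimate bounds the zeros from below uniformly in δ. Hence
exactly N smooth branches of negative zeros persist (`exists_smooth_zeros`).

Derivative. In a direction w the surface slope varies by -∫ u₀ w(u₀). Since w(1) = 0, κ varies only
through the slope, and μ_l varies by -L_l(w)/∫ φ_l², where L_l(w) = ∫ w'(u₀) φ_l² - C_l ∫ u₀ w(u₀)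
(`exists_spectrumMap`). If the L_l are linearly independent on test functions, dual test functions
make the Jacobian diagonal with nonzero entries.

Independence (`eigenvalue_functionals_independent`). Only the points with 0 < u₀ < 1 matter. They
form 2k+1 monotone branches, and on each of them u₀ is the same function U(τ) = sin(sτ)/sin(sτ₁), 0
< τ < τ₁. Let G_l be the sum of φ_l² over the branches. If Σ α_l L_l = 0, integration by parts gives
Σ α_l G_l = A cos²(sτ) + B cos(sτ). Now G_l' satisfies y'' = -4λ_l y. Differentiating and applying
d²/dτ² + s² turns the relation into one between solutions of y'' = r y with distinct r, because λ_l
< s². Thus A = 0 and α_l (s² - 4λ_l) = 0. The constant term in the equation for G_l'' gives Σ α_l =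
0, which removes the one possible exception λ_l = s²/4. This needs that no G_l' vanishes
identically, which is the elementary computation `sum_alternating_pow_ne_zero` with the exponentials
in φ_l². -/

open Set Filter Topology
open scoped ContDiff Manifold

noncomputable section

/-! ### Inverse and implicit functions of class C^∞. -/

section InverseFunction

variable {E F : Type*} [NormedAddCommGroup E] [NormedSpace ℝ E] [CompleteSpace E]
  [NormedAddCommGroup F] [NormedSpace ℝ F]

/-- Inverse function theorem for maps that are `C^∞` in a neighbourhood: the local inverse is
`C^∞` on a fixed open set. -/
theorem exists_openPartialHomeomorph_contDiffAt {f : E → F} {a : E} {f' : E ≃L[ℝ] F}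
    (hf : ∀ᶠ x in 𝓝 a, ContDiffAt ℝ ∞ f x) (hf' : HasFDerivAt f (f' : E →L[ℝ] F) a) :
    ∃ Φ : OpenPartialHomeomorph E F, a ∈ Φ.source ∧ (Φ : E → F) = f ∧
      (∀ x ∈ Φ.source, ContDiffAt ℝ ∞ f x) ∧ ∀ y ∈ Φ.target, ContDiffAt ℝ ∞ Φ.symm y := by
  have hfa : ContDiffAt ℝ ∞ f a := hf.self_of_nhds
  have hinv : ∀ᶠ x in 𝓝 a, ∃ e : E ≃L[ℝ] F, (e : E →L[ℝ] F) = fderiv ℝ f x := by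
    have hc : ContinuousAt (fderiv ℝ f) a :=
      (hfa.fderiv_right (m := 0) (by norm_num)).continuousAt
    have hn := f'.nhds
    rw [← hf'.fderiv] at hn
    exact hc.preimage_mem_nhds hn
  -- `ContDiffAt ℝ ∞` at one point provides neighbourhoods that may shrink with the order.
  -- Smoothness of the inverse is therefore checked at every point separately, which needs an
  -- invertible derivative at each.
  set S : Set E := {x | ContDiffAt ℝ ∞ f x ∧ ∃ e : E ≃L[ℝ] F, (e : E →L[ℝ] F) = fderiv ℝ f x}
    with hS
  have hSa : S ∈ 𝓝 a := hf.and hinv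
  let Φ₀ := hfa.toOpenPartialHomeomorph f hf' (by simp)
  refine ⟨Φ₀.restr S, ?_, rfl, ?_, ?_⟩
  · rw [OpenPartialHomeomorph.restr_source]
    exact ⟨hfa.mem_toOpenPartialHomeomorph_source hf' (by simp), mem_interior_iff_mem_nhds.2 hSa⟩
  · intro x hx
    rw [OpenPartialHomeomorph.restr_source] at hx
    exact (interior_subset hx.2).1
  · intro y hy
    have hx := (Φ₀.restr S).map_target hy
    rw [OpenPartialHomeomorph.restr_source] at hx
    obtain ⟨h1, e, he⟩ := interior_subset hx.2
    refine (Φ₀.restr S).contDiffAt_symm (f₀' := e) hy ?_ h1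
    rw [he]
    exact (h1.differentiableAt (by simp)).hasFDerivAt

/-- A map which is `C^∞` near `a` with invertible derivative at `a` is a local
`C^∞`-diffeomorphism at `a`. -/
theorem isLocalDiffeomorphAt_of_hasFDerivAt_equiv {f : E → F} {a : E} {f' : E ≃L[ℝ] F}
    (hf : ∀ᶠ x in 𝓝 a, ContDiffAt ℝ ∞ f x) (hf' : HasFDerivAt f (f' : E →L[ℝ] F) a) :
    IsLocalDiffeomorphAt 𝓘(ℝ, E) 𝓘(ℝ, F) ∞ f a := by
  obtain ⟨Φ, ha, hΦ, h1, h2⟩ := exists_openPartialHomeomorph_contDiffAt hf hf'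
  refine ⟨⟨Φ.toPartialEquiv, Φ.open_source, Φ.open_target, ?_, ?_⟩, ha, ?_⟩
  · intro x hx
    refine ContDiffAt.contMDiffAt (n := ∞) ?_ |>.contMDiffWithinAt
    change ContDiffAt ℝ ∞ Φ x
    rw [hΦ]
    exact h1 x hx
  · intro y hy
    exact (h2 y hy).contMDiffAt.contMDiffWithinAt
  · intro x _
    change f x = Φ x
    rw [hΦ]

variable [CompleteSpace F]

/-- Implicit function theorem for maps that are `C^∞` in a neighbourhood: the implicit function
is `C^∞` in a neighbourhood. -/
theorem exists_implicit_contDiffAt {G : E × F → F} {a : E} {c : F} (hG0 : G (a, c) = 0)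
    (hG : ∀ᶠ p in 𝓝 (a, c), ContDiffAt ℝ ∞ G p) {L : F ≃L[ℝ] F}
    (hL : HasFDerivAt (fun y => G (a, y)) (L : F →L[ℝ] F) c) :
    ∃ g : E → F, g a = c ∧ (∀ᶠ x in 𝓝 a, ContDiffAt ℝ ∞ g x) ∧
      ∀ᶠ p in 𝓝 (a, c), G p = 0 ↔ p.2 = g p.1 := by
  have hGd : HasFDerivAt G (fderiv ℝ G (a, c)) (a, c) :=
    (hG.self_of_nhds.differentiableAt (by simp)).hasFDerivAt
  set D := fderiv ℝ G (a, c) with hD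
  have hDL : ∀ y : F, D (0, y) = L y := by
    have h1 : HasFDerivAt (fun y : F => (a, y)) (ContinuousLinearMap.inr ℝ E F) c :=
      hasFDerivAt_prodMk_right a c
    have h2 := (hGd.comp c h1).unique hL
    intro y
    rw [← ContinuousLinearEquiv.coe_coe, ← h2]
    simp
  have hsplit : ∀ x y, D (x, y) = D (x, 0) + L y := by
    intro x y
    rw [← hDL, ← map_add]
    simp
  -- The derivative of `(x, y) ↦ (x, G (x, y))` is block triangular with diagonal blocks `1` and
  -- `L`, hence invertible.
  let Te : (E × F) ≃L[ℝ] (E × F) :=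
    ContinuousLinearEquiv.equivOfInverse
      ((ContinuousLinearMap.fst ℝ E F).prod D)
      ((ContinuousLinearMap.fst ℝ E F).prod ((L.symm : F →L[ℝ] F).comp
        (ContinuousLinearMap.snd ℝ E F - D.comp ((ContinuousLinearMap.inl ℝ E F).comp
          (ContinuousLinearMap.fst ℝ E F)))))
      (by
        rintro ⟨x, y⟩
        simp [hsplit x y])
      (by
        rintro ⟨x, y⟩
        rw [Prod.ext_iff]
        refine ⟨rfl, ?_⟩
        change D (x, L.symm (y - D (x, 0))) = y
        rw [hsplit]
        simp)
  have hT : HasFDerivAt (fun p : E × F => (p.1, G p)) (Te : E × F →L[ℝ] E × F) (a, c) :=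
    hasFDerivAt_fst.prodMk hGd
  obtain ⟨Φ, hs, hΦ, -, hsm⟩ := exists_openPartialHomeomorph_contDiffAt
    (f := fun p : E × F => (p.1, G p)) (hG.mono fun p hp => contDiffAt_fst.prodMk hp) hT
  have hΦa : Φ (a, c) = (a, 0) := by rw [hΦ]; simp [hG0]
  have htgt : ∀ᶠ x in 𝓝 a, ((x, 0) : E × F) ∈ Φ.target := by
    have : ((a, 0) : E × F) ∈ Φ.target := hΦa ▸ Φ.map_source hs
    have hc : ContinuousAt (fun x : E => ((x, 0) : E × F)) a := by fun_prop
    exact hc.preimage_mem_nhds (Φ.open_target.mem_nhds this)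
  refine ⟨fun x => (Φ.symm (x, 0)).2, ?_, ?_, ?_⟩
  · simp only [← hΦa, Φ.left_inv hs]
  · filter_upwards [htgt] with x hx
    exact (contDiffAt_snd).comp x ((hsm _ hx).comp x
      (contDiffAt_id.prodMk contDiffAt_const))
  · have h2 : ∀ᶠ p : E × F in 𝓝 (a, c), ((p.1, 0) : E × F) ∈ Φ.target := by
      have : Tendsto (fun p : E × F => p.1) (𝓝 (a, c)) (𝓝 a) := continuous_fst.tendsto _
      exact this.eventually htgt
    filter_upwards [Φ.open_source.mem_nhds hs, h2] with p hp hp2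
    constructor
    · intro h
      have : Φ p = (p.1, 0) := by rw [hΦ]; simp [h]
      rw [← this, Φ.left_inv hp]
    · intro h
      have h3 := Φ.right_inv hp2
      have h4 : (Φ.symm (p.1, 0)).1 = p.1 := by
        have := congrArg Prod.fst h3
        rw [hΦ] at this
        exact this
      have h5 : Φ.symm (p.1, 0) = p := Prod.ext h4 h.symm
      rw [h5, hΦ] at h3
      exact congrArg Prod.snd h3

end InverseFunction

/-! ### Smoothness of superposition operators. -/

section Nemytskii

variable {α : Type*} [TopologicalSpace α] [CompactSpace α]

/-- The range of `u` and of its perturbations lies in one compact ball, on which `w'` is uniformly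
continuous. The pointwise remainder is thus small uniformly in the point. -/
theorem hasFDerivAt_continuousMap_comp {w w' : C(ℝ, ℝ)} (hw : ∀ x, HasDerivAt w (w' x) x)
    (u : C(α, ℝ)) :
    HasFDerivAt (fun u : C(α, ℝ) => w.comp u)
      (ContinuousLinearMap.mul ℝ C(α, ℝ) (w'.comp u)) u := by
  rw [hasFDerivAt_iff_isLittleO_nhds_zero, Asymptotics.isLittleO_iff]
  intro ε hε
  have hK : IsCompact (Metric.closedBall (0 : ℝ) (‖u‖ + 1)) := isCompact_closedBall _ _
  have huc := hK.uniformContinuousOn_of_continuous w'.continuous.continuousOn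
  obtain ⟨η, hη, hηw⟩ := Metric.uniformContinuousOn_iff.1 huc ε hε
  filter_upwards [Metric.ball_mem_nhds (0 : C(α, ℝ)) (lt_min hη one_pos)] with h hh
  rw [mem_ball_zero_iff, lt_min_iff] at hh
  rw [ContinuousMap.norm_le _ (by positivity)]
  intro z
  have hu1 : ‖u z‖ ≤ ‖u‖ := u.norm_coe_le_norm z
  have hh1 : ‖h z‖ ≤ ‖h‖ := h.norm_coe_le_norm z
  have hball : ∀ y ∈ Metric.closedBall (u z) ‖h z‖, ‖w' y - w' (u z)‖ ≤ ε := by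
    intro y hy
    rw [mem_closedBall_iff_norm] at hy
    rw [← dist_eq_norm]
    refine (hηw y ?_ (u z) ?_ ?_).le
    · rw [mem_closedBall_zero_iff]
      calc ‖y‖ = ‖u z + (y - u z)‖ := by ring_nf
        _ ≤ ‖u z‖ + ‖y - u z‖ := norm_add_le _ _
        _ ≤ ‖u‖ + 1 := by linarith
    · rw [mem_closedBall_zero_iff]; linarith
    · rw [dist_eq_norm]; linarith
  -- The mean value inequality is applied to `w` minus its linear part at `u z`, so the increment is
  -- the remainder itself.
  have hmv := Convex.norm_image_sub_le_of_norm_hasDerivWithin_le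
    (f := fun y => w y - w' (u z) * y) (f' := fun y => w' y - w' (u z))
    (s := Metric.closedBall (u z) ‖h z‖) (x := u z) (y := u z + h z) (C := ε)
    (fun y _ => by
      have := (hw y).sub ((hasDerivAt_id y).const_mul (w' (u z)))
      rw [mul_one] at this
      exact this.hasDerivWithinAt)
    hball (convex_closedBall _ _) (Metric.mem_closedBall_self (norm_nonneg _)) (by simp)
  have heq : (w.comp (u + h) - w.comp u - (ContinuousLinearMap.mul ℝ C(α, ℝ) (w'.comp u)) h) z
      = (w (u z + h z) - w' (u z) * (u z + h z)) - (w (u z) - w' (u z) * u z) := by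
    simp
    ring
  rw [heq]
  refine hmv.trans ?_
  simp only [add_sub_cancel_left]
  gcongr

/-- Induction on the order: the derivative is multiplication by `w' ∘ u`, a bounded linear image of
another superposition operator. -/
theorem contDiff_nat_continuousMap_comp (n : ℕ) : ∀ w : C(ℝ, ℝ), ContDiff ℝ ∞ w →
    ContDiff ℝ n (fun u : C(α, ℝ) => w.comp u) := by
  induction n with
  | zero =>
    intro w _
    rw [Nat.cast_zero, contDiff_zero]
    exact ContinuousMap.continuous_postcomp w
  | succ n ih =>
    intro w hw
    have hd : ContDiff ℝ ∞ (deriv w) := (contDiff_infty_iff_deriv.1 hw).2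
    let w' : C(ℝ, ℝ) := ⟨deriv w, hd.continuous⟩
    rw [Nat.cast_add, Nat.cast_one, contDiff_succ_iff_hasFDerivAt]
    refine ⟨fun u => ContinuousLinearMap.mul ℝ C(α, ℝ) (w'.comp u), ?_, fun u =>
      hasFDerivAt_continuousMap_comp (w' := w')
        (fun x => ((hw.differentiable (by simp)) x).hasDerivAt) u⟩
    exact (ContinuousLinearMap.contDiff (F := C(α, ℝ) →L[ℝ] C(α, ℝ))
      (ContinuousLinearMap.mul ℝ C(α, ℝ))).comp (ih w' hd)

/-- The superposition operator `u ↦ w ∘ u` of a `C^∞` function `w` is `C^∞` on `C(α, ℝ)`. -/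
theorem contDiff_continuousMap_comp {w : C(ℝ, ℝ)} (hw : ContDiff ℝ ∞ w) :
    ContDiff ℝ ∞ (fun u : C(α, ℝ) => w.comp u) :=
  contDiff_infty.2 fun n => contDiff_nat_continuousMap_comp n w hw

end Nemytskii

/-! ### Linear equations φ'' + qφ = 0 as Volterra equations on C([0,d]). -/

section Volterra

/-- The Banach space of continuous functions on `[0,d]`. -/
abbrev Cd (d : ℝ) : Type := C(Icc (0 : ℝ) d, ℝ)

/-- The restriction to `[0,d]` of a function which is continuous there. -/
def toCd {d : ℝ} {f : ℝ → ℝ} (hf : ContinuousOn f (Icc 0 d)) : Cd d :=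
  ⟨(Icc 0 d).domRestrict f, hf.domRestrict⟩

@[simp] theorem toCd_apply {d : ℝ} {f : ℝ → ℝ} (hf : ContinuousOn f (Icc 0 d)) (z : Icc (0 : ℝ) d) :
    toCd hf z = f z := rfl

variable {d : ℝ} [hd : Fact (0 < d)]

/-- The extension of a continuous function on `[0,d]` to `ℝ` by its boundary values. -/
def extC (f : Cd d) : ℝ → ℝ := IccExtend hd.out.le f

/-- The left end point of `[0,d]`. -/
def botPt (d : ℝ) [hd : Fact (0 < d)] : Icc (0 : ℝ) d := ⟨0, left_mem_Icc.2 hd.out.le⟩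

/-- The right end point of `[0,d]`. -/
def topPt (d : ℝ) [hd : Fact (0 < d)] : Icc (0 : ℝ) d := ⟨d, right_mem_Icc.2 hd.out.le⟩

/-- The coordinate function `z ↦ z` on `[0,d]`. -/
def coordC (d : ℝ) : Cd d := ⟨Subtype.val, continuous_subtype_val⟩

/-- Evaluation at the surface `z = d`. -/
def evalTop (d : ℝ) [Fact (0 < d)] : Cd d →L[ℝ] ℝ := ContinuousMap.evalCLM ℝ (topPt d)

@[simp] theorem evalTop_apply (f : Cd d) : evalTop d f = f (topPt d) := rfl

theorem extC_coe (f : Cd d) (z : Icc (0 : ℝ) d) : extC f z = f z := by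
  exact IccExtend_val _ _ z

theorem extC_mem (f : Cd d) {z : ℝ} (hz : z ∈ Icc 0 d) : extC f z = f ⟨z, hz⟩ :=
  extC_coe f ⟨z, hz⟩

theorem extC_toCd {f : ℝ → ℝ} (hf : ContinuousOn f (Icc 0 d)) {z : ℝ} (hz : z ∈ Icc 0 d) :
    extC (toCd hf) z = f z := by
  rw [extC_mem _ hz]; rfl

theorem continuous_extC (f : Cd d) : Continuous (extC f) :=
  f.continuous.Icc_extend'

theorem abs_extC_le (f : Cd d) (z : ℝ) : |extC f z| ≤ ‖f‖ :=
  f.norm_coe_le_norm _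

/-- The operator `f ↦ ∫₀ᶻ f` on `C([0,d])`. -/
def prim (d : ℝ) [hd : Fact (0 < d)] : Cd d →L[ℝ] Cd d :=
  LinearMap.mkContinuous
    { toFun := fun f => ⟨fun z => ∫ t in (0 : ℝ)..z, extC f t,
        (intervalIntegral.continuous_primitive
          (fun a b => (continuous_extC f).intervalIntegrable a b) 0).comp continuous_subtype_val⟩
      map_add' := fun f g => by
        ext z
        exact intervalIntegral.integral_add ((continuous_extC f).intervalIntegrable _ _)
          ((continuous_extC g).intervalIntegrable _ _)
      map_smul' := fun c f => by
        ext z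
        exact intervalIntegral.integral_const_mul c (extC f) }
    d (fun f => by
      have hd0 := hd.out
      rw [ContinuousMap.norm_le _ (by positivity)]
      intro z
      have h := intervalIntegral.norm_integral_le_of_norm_le_const (a := (0 : ℝ)) (b := z)
        (f := extC f) (C := ‖f‖) (fun t _ => abs_extC_le f t)
      refine h.trans ?_
      have hz := z.2
      rw [sub_zero, abs_of_nonneg hz.1, mul_comm]
      gcongr
      exact hz.2)

theorem prim_apply (f : Cd d) (z : Icc (0 : ℝ) d) :
    prim d f z = ∫ t in (0 : ℝ)..z, extC f t := rfl

@[simp] theorem prim_bot (f : Cd d) : prim d f (botPt d) = 0 := by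
  simp [prim_apply, botPt]

theorem hasDerivWithinAt_extC_prim (f : Cd d) {z : ℝ} (hz : z ∈ Icc 0 d) :
    HasDerivWithinAt (extC (prim d f)) (extC f z) (Icc 0 d) z := by
  have h : HasDerivAt (fun z : ℝ => ∫ t in (0 : ℝ)..z, extC f t) (extC f z) z :=
    intervalIntegral.integral_hasDerivAt_right ((continuous_extC f).intervalIntegrable _ _)
      ((continuous_extC f).stronglyMeasurableAtFilter _ _) (continuous_extC f).continuousAt
  refine h.hasDerivWithinAt.congr (fun y hy => ?_) ?_
  · rw [extC_mem _ hy, prim_apply]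
  · rw [extC_mem _ hz, prim_apply]

/-- The passage from differential relations to equations in the Banach space `Cd d`, on which every
later argument works. -/
theorem eq_const_add_prim {f g : Cd d}
    (h : ∀ z ∈ Icc 0 d, HasDerivWithinAt (extC f) (extC g z) (Icc 0 d) z) :
    f = f (botPt d) • 1 + prim d g := by
  ext z
  have hval : ∫ t in (0 : ℝ)..z, extC g t = extC f z - extC f 0 := by
    refine intervalIntegral.integral_eq_sub_of_hasDerivAt_of_le z.2.1 ?_ ?_
      ((continuous_extC g).intervalIntegrable _ _)
    · exact (continuous_extC f).continuousOn
    · intro x hx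
      have hx' : x ∈ Icc 0 d := ⟨hx.1.le, hx.2.le.trans z.2.2⟩
      exact (h x hx').hasDerivAt (Icc_mem_nhds hx.1 (hx.2.trans_le z.2.2))
  have h0 : extC f 0 = f (botPt d) := extC_coe f (botPt d)
  rw [extC_coe, h0] at hval
  simp only [ContinuousMap.add_apply, ContinuousMap.smul_apply, ContinuousMap.one_apply,
    smul_eq_mul, mul_one, prim_apply, hval]
  ring

theorem hasDerivWithinAt_extC_const_add_prim (a : ℝ) (f : Cd d) {z : ℝ} (hz : z ∈ Icc 0 d) :
    HasDerivWithinAt (extC (a • 1 + prim d f)) (extC f z) (Icc 0 d) z := by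
  have : extC (a • 1 + prim d f) = fun z => a * 1 + extC (prim d f) z := rfl
  rw [this]
  exact (hasDerivWithinAt_extC_prim f hz).const_add _

theorem prim_one : prim d 1 = coordC d := by
  ext z
  rw [prim_apply]
  have : extC (1 : Cd d) = fun _ => 1 := rfl
  simp [this, coordC]

/-- Green's second identity for solutions vanishing at `0`. -/
theorem green_identity {φ ψ g φ' ψ' g' : Cd d} {a a' : ℝ}
    (h1 : φ = prim d ψ) (h2 : ψ = a • 1 - prim d g)
    (h1' : φ' = prim d ψ') (h2' : ψ' = a' • 1 - prim d g') :
    φ (topPt d) * ψ' (topPt d) - φ' (topPt d) * ψ (topPt d)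
      = prim d (φ' * g - φ * g') (topPt d) := by
  have key : ∀ {φ ψ g : Cd d} {a : ℝ}, φ = prim d ψ → ψ = a • 1 - prim d g →
      (φ (botPt d) = 0 ∧ ∀ z ∈ Icc 0 d, HasDerivWithinAt (extC φ) (extC ψ z) (Icc 0 d) z ∧
        HasDerivWithinAt (extC ψ) (-extC g z) (Icc 0 d) z) := by
    intro φ ψ g a h1 h2
    refine ⟨by rw [h1]; simp, fun z hz => ⟨?_, ?_⟩⟩
    · rw [h1]; exact hasDerivWithinAt_extC_prim ψ hz
    · have h3 : ψ = a • 1 + prim d (-g) := by rw [h2, map_neg, sub_eq_add_neg]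
      rw [h3]
      exact hasDerivWithinAt_extC_const_add_prim a (-g) hz
  obtain ⟨b0, k⟩ := key h1 h2
  obtain ⟨b0', k'⟩ := key h1' h2'
  have := eq_const_add_prim (f := φ * ψ' - φ' * ψ) (g := φ' * g - φ * g') (fun z hz => by
    have h := ((k z hz).1.mul (k' z hz).2).sub ((k' z hz).1.mul (k z hz).2)
    refine h.congr_deriv ?_
    change _ = extC φ' z * extC g z - extC φ z * extC g' z
    ring)
  have h3 := congrArg (fun f : Cd d => f (topPt d)) this
  simpa [b0, b0'] using h3

theorem abs_prim_le_of_le_pow {f : Cd d} {C : ℝ} {n : ℕ}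
    (h : ∀ z : Icc (0 : ℝ) d, |f z| ≤ C * (z : ℝ) ^ n) (z : Icc (0 : ℝ) d) :
    |prim d f z| ≤ C / (n + 1) * (z : ℝ) ^ (n + 1) := by
  have h1 : ‖∫ t in (0 : ℝ)..z, extC f t‖ ≤ ∫ t in (0 : ℝ)..z, C * t ^ n := by
    refine intervalIntegral.norm_integral_le_of_norm_le z.2.1 ?_
      (Continuous.intervalIntegrable (by fun_prop) _ _)
    refine Eventually.of_forall fun t ht => ?_
    have ht' : t ∈ Icc 0 d := ⟨ht.1.le, ht.2.trans z.2.2⟩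
    rw [extC_mem _ ht']
    exact h ⟨t, ht'⟩
  rw [intervalIntegral.integral_const_mul, integral_pow] at h1
  rw [prim_apply]
  refine h1.trans (le_of_eq ?_)
  simp
  ring

/-- The Volterra operator `f ↦ ∫₀ᶻ ∫₀ᵗ q f`, as a function of the potential `q`. -/
def volterra (d : ℝ) [Fact (0 < d)] : Cd d →L[ℝ] (Cd d →L[ℝ] Cd d) :=
  (ContinuousLinearMap.compL ℝ (Cd d) (Cd d) (Cd d) ((prim d).comp (prim d))).comp
    (ContinuousLinearMap.mul ℝ (Cd d))

@[simp] theorem volterra_apply (q f : Cd d) : volterra d q f = prim d (prim d (q * f)) := rfl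

/-- Each double integration raises the power of `z` by two and divides by the next two integers. -/
theorem abs_volterra_pow_le (q f : Cd d) (n : ℕ) (z : Icc (0 : ℝ) d) :
    |(volterra d q ^ n) f z| ≤ ‖q‖ ^ n * ‖f‖ / (2 * n).factorial * (z : ℝ) ^ (2 * n) := by
  induction n generalizing z with
  | zero => simpa using f.norm_coe_le_norm z
  | succ n ih =>
    rw [pow_succ']
    change |prim d (prim d (q * (volterra d q ^ n) f)) z| ≤ _
    have h0 : ∀ z : Icc (0 : ℝ) d, |(q * (volterra d q ^ n) f) z|
        ≤ (‖q‖ * (‖q‖ ^ n * ‖f‖ / (2 * n).factorial)) * (z : ℝ) ^ (2 * n) := by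
      intro z
      rw [ContinuousMap.mul_apply, abs_mul, mul_assoc]
      exact mul_le_mul (q.norm_coe_le_norm z) (ih z) (abs_nonneg _) (norm_nonneg _)
    have h2 := abs_prim_le_of_le_pow (abs_prim_le_of_le_pow h0) z
    refine h2.trans (le_of_eq ?_)
    have e : 2 * (n + 1) = 2 * n + 1 + 1 := by ring
    rw [e, Nat.factorial_succ, Nat.factorial_succ]
    push_cast
    field_simp
    ring

theorem norm_volterra_pow_le (q : Cd d) (n : ℕ) :
    ‖volterra d q ^ n‖ ≤ (‖q‖ * d ^ 2) ^ n / n.factorial := by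
  have hd0 := hd.out
  refine ContinuousLinearMap.opNorm_le_bound _ (by positivity) fun f => ?_
  rw [ContinuousMap.norm_le _ (by positivity)]
  intro z
  refine (abs_volterra_pow_le q f n z).trans ?_
  have hz := z.2
  have h1 : ((z : ℝ)) ^ (2 * n) ≤ d ^ (2 * n) := pow_le_pow_left₀ hz.1 hz.2 _
  have h2 : (n.factorial : ℝ) ≤ (2 * n).factorial := by
    exact_mod_cast Nat.factorial_le (by omega)
  have h3 : (0 : ℝ) < n.factorial := by positivity
  calc ‖q‖ ^ n * ‖f‖ / (2 * n).factorial * (z : ℝ) ^ (2 * n)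
      ≤ ‖q‖ ^ n * ‖f‖ / n.factorial * d ^ (2 * n) := by
        gcongr
        exact pow_nonneg hz.1 _
    _ = _ := by rw [mul_pow, ← pow_mul]; ring

/-- `1 + x` is a factor of `1 - (-x)^n`, which is invertible, and the cofactor is a polynomial in
`x` and commutes with it. A small power thus suffices where `x` itself may be large. -/
theorem isUnit_one_add_of_norm_pow_lt_one {R : Type*} [NormedRing R] [HasSummableGeomSeries R]
    {x : R} {n : ℕ} (h : ‖x ^ n‖ < 1) : IsUnit (1 + x) := by
  have h1 : IsUnit (1 - (-x) ^ n) := by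
    refine isUnit_one_sub_of_norm_lt_one ?_
    rcases n.even_or_odd with h' | h'
    · rwa [h'.neg_pow]
    · rwa [h'.neg_pow, norm_neg]
  rw [← geom_sum_mul_neg (-x) n] at h1
  have hc : Commute (∑ i ∈ Finset.range n, (-x) ^ i) (1 - -x) := by
    refine Commute.sum_left _ _ _ fun i _ => ?_
    exact ((Commute.one_right _).sub_right (Commute.refl _)).pow_left i
  have := (hc.isUnit_mul_iff.1 h1).2
  simpa using this

theorem isUnit_one_add_volterra (q : Cd d) : IsUnit (1 + volterra d q) := by
  have h := FloorSemiring.tendsto_pow_div_factorial_atTop (‖q‖ * d ^ 2)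
  obtain ⟨n, hn⟩ := (h.eventually (gt_mem_nhds one_pos)).exists
  exact isUnit_one_add_of_norm_pow_lt_one (R := Cd d →L[ℝ] Cd d) ((norm_volterra_pow_le q n).trans_lt hn)

/-- The inverse of `1 + volterra q`. -/
def volterraInv (q : Cd d) : Cd d →L[ℝ] Cd d := Ring.inverse (1 + volterra d q)

theorem volterraInv_spec (q f : Cd d) :
    volterraInv q f + prim d (prim d (q * volterraInv q f)) = f := by
  have := Ring.mul_inverse_cancel _ (isUnit_one_add_volterra q)
  have h2 := congrArg (fun A : Cd d →L[ℝ] Cd d => A f) this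
  exact h2

theorem eq_volterraInv {q f g : Cd d} (h : f + prim d (prim d (q * f)) = g) :
    f = volterraInv q g := by
  have := Ring.inverse_mul_cancel _ (isUnit_one_add_volterra q)
  have h2 := congrArg (fun A : Cd d →L[ℝ] Cd d => A f) this
  rw [← h]
  exact h2.symm

/-- Inversion is smooth at units, and `volterra` is continuous and linear in the potential. -/
theorem contDiff_volterraInv : ContDiff ℝ ∞ (volterraInv : Cd d → Cd d →L[ℝ] Cd d) := by
  rw [contDiff_iff_contDiffAt]
  intro q
  obtain ⟨y, hy⟩ := isUnit_one_add_volterra q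
  have h1 := contDiffAt_ringInverse (n := ∞) (R := Cd d →L[ℝ] Cd d) ℝ y
  rw [hy] at h1
  have h2 : ContDiff ℝ ∞ (fun q : Cd d => 1 + volterra d q) :=
    contDiff_const.add (by fun_prop)
  exact ContDiffAt.comp q h1 h2.contDiffAt

/-- The solution of `φ'' + q φ = 0`, `φ(0) = 0`, `φ'(0) = 1`. -/
def phi (q : Cd d) : Cd d := volterraInv q (coordC d)

/-- The derivative of `phi q`. -/
def psi (q : Cd d) : Cd d := 1 - prim d (q * phi q)

theorem phi_eq (q : Cd d) : phi q = prim d (psi q) := by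
  rw [psi, map_sub, prim_one]
  exact eq_sub_of_add_eq (volterraInv_spec q _)

theorem contDiff_phi : ContDiff ℝ ∞ (phi : Cd d → Cd d) :=
  contDiff_volterraInv.clm_apply contDiff_const

theorem contDiff_psi : ContDiff ℝ ∞ (psi : Cd d → Cd d) :=
  contDiff_const.sub ((prim d).contDiff.comp (contDiff_id.mul contDiff_phi))

/-- Solutions of the linear equation `φ'' + q φ = 0` with `φ(0) = 0` are multiples of `phi q`. -/
theorem eq_smul_phi {q : Cd d} {f v : ℝ → ℝ}
    (h : ∀ z ∈ Icc 0 d, HasDerivWithinAt f (v z) (Icc 0 d) z ∧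
      HasDerivWithinAt v (-(extC q z * f z)) (Icc 0 d) z) (h0 : f 0 = 0) :
    ∀ z : Icc (0 : ℝ) d, f z = v 0 * phi q z ∧ v z = v 0 * psi q z := by
  have hf : ContinuousOn f (Icc 0 d) := fun z hz => (h z hz).1.continuousWithinAt
  have hv : ContinuousOn v (Icc 0 d) := fun z hz => (h z hz).2.continuousWithinAt
  have e1 := eq_const_add_prim (f := toCd hf) (g := toCd hv) (fun z hz => by
    rw [extC_toCd hv hz]
    exact (h z hz).1.congr (fun y hy => extC_toCd hf hy) (extC_toCd hf hz))
  have e2 := eq_const_add_prim (f := toCd hv) (g := -(q * toCd hf)) (fun z hz => by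
    change HasDerivWithinAt _ (-(extC q z * extC (toCd hf) z)) _ _
    rw [extC_toCd hf hz]
    exact (h z hz).2.congr (fun y hy => extC_toCd hv hy) (extC_toCd hv hz))
  have hb : (toCd hf) (botPt d) = 0 := h0
  have hb2 : (toCd hv) (botPt d) = v 0 := rfl
  rw [hb, zero_smul, zero_add] at e1
  rw [hb2, map_neg] at e2
  have e3 : toCd hf + prim d (prim d (q * toCd hf)) = v 0 • coordC d := by
    have : toCd hf = v 0 • prim d 1 - prim d (prim d (q * toCd hf)) := by
      conv_lhs => rw [e1, e2]
      rw [map_add, map_smul, map_neg, sub_eq_add_neg]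
    rw [prim_one] at this
    exact eq_sub_iff_add_eq.1 this
  have e4 : toCd hf = v 0 • phi q := by
    rw [eq_volterraInv e3, map_smul]; rfl
  have e5 : toCd hv = v 0 • psi q := by
    rw [e2, e4, psi, mul_smul_comm, map_smul, smul_sub, sub_eq_add_neg]
  intro z
  exact ⟨congrArg (fun F : Cd d => F z) e4, congrArg (fun F : Cd d => F z) e5⟩

theorem hasDerivWithinAt_phi (q : Cd d) {z : ℝ} (hz : z ∈ Icc 0 d) :
    HasDerivWithinAt (extC (phi q)) (extC (psi q) z) (Icc 0 d) z := by
  conv in phi q => rw [phi_eq]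
  exact hasDerivWithinAt_extC_prim _ hz

theorem hasDerivWithinAt_psi (q : Cd d) {z : ℝ} (hz : z ∈ Icc 0 d) :
    HasDerivWithinAt (extC (psi q)) (-(extC q z * extC (phi q) z)) (Icc 0 d) z := by
  have h3 : psi q = (1 : ℝ) • 1 + prim d (-(q * phi q)) := by
    rw [psi, map_neg, one_smul, sub_eq_add_neg]
  rw [h3]
  exact hasDerivWithinAt_extC_const_add_prim 1 _ hz

@[simp] theorem phi_bot (q : Cd d) : phi q (botPt d) = 0 := by
  rw [phi_eq]; simp

@[simp] theorem psi_bot (q : Cd d) : psi q (botPt d) = 1 := by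
  simp [psi]

/-- The eigenvalues are the zeros of the characteristic function `psi(d) - κ phi(d)`. -/
theorem isSLEigenvalue_iff {om u : ℝ → ℝ} {μ : ℝ} {q : Cd d}
    (hq : ∀ z : Icc (0 : ℝ) d, q z = deriv om (u z) + μ) :
    IsSLEigenvalue om d u μ ↔
      psi q (topPt d) - kappa om d u * phi q (topPt d) = 0 := by
  constructor
  · rintro ⟨φ, ψ, h, h0, hb, z, hz, hne⟩
    have hs := eq_smul_phi (q := q) (f := φ) (v := ψ) (fun z hz => ⟨(h z hz).1, by
      convert (h z hz).2 using 1
      rw [extC_mem _ hz, hq ⟨z, hz⟩]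
      ring⟩) h0
    have hv : ψ 0 ≠ 0 := by
      intro h1
      apply hne
      have := (hs ⟨z, hz⟩).1
      simpa [h1] using this
    obtain ⟨ha, hb'⟩ := hs (topPt d)
    change φ d = _ at ha
    change ψ d = _ at hb'
    rw [ha, hb'] at hb
    apply mul_left_cancel₀ hv
    linear_combination hb
  · intro h
    refine ⟨extC (phi q), extC (psi q), fun z hz => ⟨hasDerivWithinAt_phi q hz, ?_⟩, ?_, ?_, ?_⟩
    · convert hasDerivWithinAt_psi q hz using 1
      rw [extC_mem q hz, hq ⟨z, hz⟩]
      ring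
    · exact (extC_coe _ (botPt d)).trans (phi_bot q)
    · have h1 : extC (psi q) d = psi q (topPt d) := extC_coe _ (topPt d)
      have h2 : extC (phi q) d = phi q (topPt d) := extC_coe _ (topPt d)
      rw [h1, h2]
      linarith
    · by_contra hcon
      push Not at hcon
      have hz : phi q = 0 := by
        ext z
        rw [← extC_coe]
        exact hcon z z.2
      have h1 : psi q = 1 := by rw [psi, hz]; simp
      rw [h1, hz] at h
      simp at h

end Volterra

/-! ### Stream solutions of the perturbed vorticity. -/

section Stream

variable {d : ℝ} {N : ℕ}

/-- The perturbation `Σ δ_k w_k ∘ u`. -/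
def pert (W : Fin N → C(ℝ, ℝ)) (δ : Fin N → ℝ) (u : Cd d) : Cd d := ∑ k, δ k • (W k).comp u

/-- The perturbed vorticity as a continuous map. -/
def vorticityC (b : ℝ) (W : Fin N → C(ℝ, ℝ)) (δ : Fin N → ℝ) : C(ℝ, ℝ) :=
  b • ContinuousMap.id ℝ + ∑ k, δ k • W k

theorem coe_vorticityC (b : ℝ) (W : Fin N → C(ℝ, ℝ)) (δ : Fin N → ℝ) :
    (vorticityC b W δ : ℝ → ℝ) = perturbedVorticity b (fun k => W k) δ := by
  ext x
  simp [vorticityC, perturbedVorticity, ContinuousMap.sum_apply]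

theorem vorticityC_comp (b : ℝ) (W : Fin N → C(ℝ, ℝ)) (δ : Fin N → ℝ) (u : Cd d) :
    (vorticityC b W δ).comp u = b • u + pert W δ u := by
  ext x
  simp [vorticityC, pert, ContinuousMap.sum_apply]

theorem contDiff_pert {W : Fin N → C(ℝ, ℝ)} (hW : ∀ k, ContDiff ℝ ∞ (W k)) :
    ContDiff ℝ ∞ (fun p : (Fin N → ℝ) × Cd d => pert W p.1 p.2) := by
  unfold pert
  refine ContDiff.sum fun k _ => ?_
  have h1 : ContDiff ℝ ∞ (fun p : (Fin N → ℝ) × Cd d => p.1 k) :=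
    (contDiff_apply ℝ ℝ k).comp contDiff_fst
  exact h1.smul ((contDiff_continuousMap_comp (hW k)).comp contDiff_snd)

/-- The Lipschitz constant tends to zero with `δ`, which yields uniqueness among all solutions and
not only near `linStream`. -/
theorem norm_pert_sub_le {W : Fin N → C(ℝ, ℝ)} {C : ℝ} (hC : 0 ≤ C)
    (hW : ∀ k x y, |W k x - W k y| ≤ C * |x - y|) (δ : Fin N → ℝ) (u v : Cd d) :
    ‖pert W δ u - pert W δ v‖ ≤ (N * ‖δ‖ * C) * ‖u - v‖ := by
  unfold pert
  rw [← Finset.sum_sub_distrib]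
  have : ∀ k ∈ Finset.univ, ‖δ k • (W k).comp u - δ k • (W k).comp v‖ ≤ ‖δ‖ * C * ‖u - v‖ := by
    intro k _
    rw [← smul_sub, norm_smul, mul_assoc]
    refine mul_le_mul (norm_le_pi_norm δ k) ?_ (norm_nonneg _) (norm_nonneg _)
    rw [ContinuousMap.norm_le _ (by positivity)]
    intro z
    refine (hW k _ _).trans ?_
    gcongr
    exact (u - v).norm_coe_le_norm z
  refine (norm_sum_le_of_le _ this).trans (le_of_eq ?_)
  simp
  ring

variable [hd : Fact (0 < d)]

/-- The free constant `a` is the slope at the bottom. -/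
theorem IsStreamSolution.exists_integral_eq {om : C(ℝ, ℝ)} {u : ℝ → ℝ}
    (h : IsStreamSolution om d u) :
    ∃ U : Cd d, (∀ z : Icc (0 : ℝ) d, U z = u z) ∧ U (topPt d) = 1 ∧
      ∃ a : ℝ, U = a • coordC d - prim d (prim d (om.comp U)) := by
  obtain ⟨⟨v, hv⟩, h0, h1⟩ := h
  have hc : ContinuousOn u (Icc 0 d) := fun z hz => (hv z hz).1.continuousWithinAt
  have hvc : ContinuousOn v (Icc 0 d) := fun z hz => (hv z hz).2.continuousWithinAt
  have e1 := eq_const_add_prim (f := toCd hc) (g := toCd hvc) (fun z hz => by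
    rw [extC_toCd hvc hz]
    exact (hv z hz).1.congr (fun y hy => extC_toCd hc hy) (extC_toCd hc hz))
  have e2 := eq_const_add_prim (f := toCd hvc) (g := -(om.comp (toCd hc))) (fun z hz => by
    change HasDerivWithinAt _ (-(om (extC (toCd hc) z))) _ _
    rw [extC_toCd hc hz]
    exact (hv z hz).2.congr (fun y hy => extC_toCd hvc hy) (extC_toCd hvc hz))
  have hb : (toCd hc) (botPt d) = 0 := h0
  rw [hb, zero_smul, zero_add] at e1
  refine ⟨toCd hc, fun z => rfl, h1, toCd hvc (botPt d), ?_⟩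
  conv_lhs => rw [e1, e2]
  rw [map_add, map_smul, map_neg, map_neg, prim_one, sub_eq_add_neg]

theorem isStreamSolution_of_integral_eq {om : C(ℝ, ℝ)} {U : Cd d} {a : ℝ}
    (h : U = a • coordC d - prim d (prim d (om.comp U))) (h1 : U (topPt d) = 1) :
    IsStreamSolution om d (extC U) ∧
      surfaceSlope d (extC U) = a - prim d (om.comp U) (topPt d) := by
  set v : Cd d := a • 1 + prim d (-(om.comp U)) with hv
  have hU : U = prim d v := by
    conv_lhs => rw [h]
    rw [hv, map_add, map_smul, map_neg, map_neg, prim_one, sub_eq_add_neg]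
  have hd1 : ∀ z ∈ Icc 0 d, HasDerivWithinAt (extC U) (extC v z) (Icc 0 d) z := by
    intro z hz
    rw [hU]
    exact hasDerivWithinAt_extC_prim v hz
  refine ⟨⟨⟨extC v, fun z hz => ⟨hd1 z hz, ?_⟩⟩, ?_, ?_⟩, ?_⟩
  · exact hasDerivWithinAt_extC_const_add_prim a _ hz
  · refine (extC_coe U (botPt d)).trans ?_
    rw [hU]; simp
  · exact (extC_coe U (topPt d)).trans h1
  · have hdm : d ∈ Icc 0 d := right_mem_Icc.2 hd.out.le
    rw [surfaceSlope, (hd1 d hdm).derivWithin (uniqueDiffOn_Icc hd.out d hdm)]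
    refine (extC_coe v (topPt d)).trans ?_
    rw [hv]
    simp [sub_eq_add_neg]

/-- The operator `f ↦ y` with `y'' + b y = f`, `y(0) = y'(0) = 0`. -/
def duhamel (d : ℝ) [Fact (0 < d)] (b : ℝ) : Cd d →L[ℝ] Cd d :=
  (volterraInv (b • (1 : Cd d))).comp ((prim d).comp (prim d))

/-- The stream solution of the linear vorticity. -/
def linStream (d : ℝ) [Fact (0 < d)] (b : ℝ) : Cd d :=
  (phi (b • (1 : Cd d)) (topPt d))⁻¹ • phi (b • (1 : Cd d))

/-- The operator `f ↦ y` with `y'' + b y = -f`, `y(0) = y(d) = 0`. -/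
def dirichletInv (d : ℝ) [Fact (0 < d)] (b : ℝ) : Cd d →L[ℝ] Cd d :=
  ((evalTop d).comp (duhamel d b)).smulRight (linStream d b) - duhamel d b

theorem dirichletInv_apply (b : ℝ) (f : Cd d) :
    dirichletInv d b f = duhamel d b f (topPt d) • linStream d b - duhamel d b f := rfl

/-- Variation of constants inverts the linear part, and the condition at the surface determines `a`.
What is left is a fixed point equation without a free constant. -/
theorem integral_eq_iff {b : ℝ} (hβ : phi (b • (1 : Cd d)) (topPt d) ≠ 0) (U g : Cd d) :
    (U (topPt d) = 1 ∧ ∃ a : ℝ, U = a • coordC d - prim d (prim d (b • U + g))) ↔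
      U = linStream d b + dirichletInv d b g := by
  have hb : ∀ f : Cd d, b • (1 : Cd d) * f = b • f := fun f => by rw [smul_mul_assoc, one_mul]
  have hlin : linStream d b (topPt d) = 1 := inv_mul_cancel₀ hβ
  constructor
  · rintro ⟨h1, a, ha⟩
    have h2 : U + prim d (prim d (b • (1 : Cd d) * U)) = a • coordC d - prim d (prim d g) := by
      rw [hb]
      conv_lhs => enter [1]; rw [ha]
      simp only [map_add]
      abel
    have h3 := eq_volterraInv h2
    rw [map_sub, map_smul] at h3
    change U = a • phi (b • (1 : Cd d)) - duhamel d b g at h3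
    have h4 := congrArg (fun f : Cd d => f (topPt d)) h3
    simp only [h1, ContinuousMap.sub_apply, ContinuousMap.smul_apply, smul_eq_mul] at h4
    have ha : a = (1 + duhamel d b g (topPt d)) * (phi (b • (1 : Cd d)) (topPt d))⁻¹ := by
      field_simp
      linarith
    rw [h3, ha, mul_smul, dirichletInv_apply]
    change (1 + duhamel d b g (topPt d)) • linStream d b - _ = _
    rw [add_smul, one_smul]
    abel
  · intro h
    constructor
    · rw [h, dirichletInv_apply]
      simp [hlin]
    · refine ⟨(1 + duhamel d b g (topPt d)) * (phi (b • (1 : Cd d)) (topPt d))⁻¹, ?_⟩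
      set a := (1 + duhamel d b g (topPt d)) * (phi (b • (1 : Cd d)) (topPt d))⁻¹ with ha
      have h3 : U = volterraInv (b • (1 : Cd d)) (a • coordC d - prim d (prim d g)) := by
        rw [map_sub, map_smul]
        change U = a • phi (b • (1 : Cd d)) - duhamel d b g
        rw [h, ha, mul_smul, dirichletInv_apply]
        change _ = (1 + duhamel d b g (topPt d)) • linStream d b - _
        rw [add_smul, one_smul]
        abel
      have h4 := volterraInv_spec (b • (1 : Cd d)) (a • coordC d - prim d (prim d g))
      rw [← h3, hb] at h4
      rw [map_add, map_add, add_comm (prim d (prim d (b • U))), ← sub_sub]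
      exact eq_sub_of_add_eq h4

/-- For small `δ` the equation of the stream solution has exactly one solution, and it depends
smoothly on `δ`. -/
theorem exists_stream_family (b : ℝ) {W : Fin N → C(ℝ, ℝ)} (hW : ∀ k, ContDiff ℝ ∞ (W k)) {C : ℝ}
    (hC : 0 ≤ C) (hL : ∀ k x y, |W k x - W k y| ≤ C * |x - y|) :
    ∃ U : (Fin N → ℝ) → Cd d, U 0 = linStream d b ∧ (∀ᶠ δ in 𝓝 0, ContDiffAt ℝ ∞ U δ) ∧
      ∀ᶠ δ in 𝓝 0, ∀ V : Cd d, V = linStream d b + dirichletInv d b (pert W δ V) ↔ V = U δ := by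
  let G : (Fin N → ℝ) × Cd d → Cd d := fun p =>
    p.2 - (linStream d b + dirichletInv d b (pert W p.1 p.2))
  have hG : ContDiff ℝ ∞ G :=
    contDiff_snd.sub (contDiff_const.add ((dirichletInv d b).contDiff.comp (contDiff_pert hW)))
  have hp0 : ∀ V : Cd d, pert W 0 V = 0 := fun V => by simp [pert]
  obtain ⟨U, hU0, hUs, hUe⟩ := exists_implicit_contDiffAt (G := G) (a := 0) (c := linStream d b)
    (by simp [G, hp0]) (Eventually.of_forall fun p => hG.contDiffAt)
    -- At `δ = 0` the perturbation vanishes, so `G (0, ·)` is a translation.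
    (L := ContinuousLinearEquiv.refl ℝ (Cd d)) (by
      have : (fun y => G (0, y)) = fun y => y - linStream d b := by
        funext y
        simp [G, hp0]
      rw [this]
      exact (hasFDerivAt_id _).sub_const _)
  refine ⟨U, hU0, hUs, ?_⟩
  have hcont : Tendsto (fun δ => (δ, U δ)) (𝓝 0) (𝓝 (0, linStream d b)) := by
    rw [← hU0]
    exact (continuousAt_id.prodMk hUs.self_of_nhds.continuousAt)
  -- The implicit function theorem gives uniqueness only near `linStream`. For such `δ` the
  -- right-hand side of the equation is a contraction on the whole space.
  have hsmall : ∀ᶠ δ : Fin N → ℝ in 𝓝 0, ‖dirichletInv d b‖ * (N * ‖δ‖ * C) < 1 := by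
    have : Continuous fun δ : Fin N → ℝ => ‖dirichletInv d b‖ * (N * ‖δ‖ * C) := by fun_prop
    exact this.continuousAt.eventually_lt continuousAt_const (by simp)
  filter_upwards [hcont.eventually hUe, hsmall] with δ h1 h2 V
  have hUδ : U δ = linStream d b + dirichletInv d b (pert W δ (U δ)) := by
    have := h1.2 rfl
    exact sub_eq_zero.1 this
  constructor
  · intro hV
    by_contra hne
    have hpos : 0 < ‖V - U δ‖ := norm_pos_iff.2 (sub_ne_zero.2 hne)
    have : ‖V - U δ‖ ≤ ‖dirichletInv d b‖ * ((N * ‖δ‖ * C) * ‖V - U δ‖) := by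
      conv_lhs => rw [hV, hUδ]
      rw [add_sub_add_left_eq_sub, ← map_sub]
      refine (ContinuousLinearMap.le_opNorm _ _).trans ?_
      gcongr
      exact norm_pert_sub_le hC hL δ _ _
    nlinarith
  · rintro rfl
    exact hUδ

/-- The surface slope of the stream solution `u` of the vorticity `b p + Σ δ_k w_k(p)`. -/
def slopeC (b : ℝ) (W : Fin N → C(ℝ, ℝ)) (δ : Fin N → ℝ) (u : Cd d) : ℝ :=
  (1 + prim d (prim d (b • u + pert W δ u)) (topPt d)) / d
    - prim d (b • u + pert W δ u) (topPt d)

/-- Evaluation at the surface gives `a`. The slope thereby becomes an explicit smooth function of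
`(δ, u)`. -/
theorem slopeC_eq {b a : ℝ} {W : Fin N → C(ℝ, ℝ)} {δ : Fin N → ℝ} {U : Cd d}
    (h : U = a • coordC d - prim d (prim d (b • U + pert W δ U))) (h1 : U (topPt d) = 1) :
    slopeC b W δ U = a - prim d (b • U + pert W δ U) (topPt d) := by
  have h2 := congrArg (fun f : Cd d => f (topPt d)) h
  have hc : coordC d (topPt d) = d := rfl
  simp only [h1, ContinuousMap.sub_apply, ContinuousMap.smul_apply, smul_eq_mul, hc] at h2
  have hd0 := hd.out.ne'
  rw [slopeC]
  congr 1
  field_simp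
  linarith

theorem contDiff_slopeC (b : ℝ) {W : Fin N → C(ℝ, ℝ)} (hW : ∀ k, ContDiff ℝ ∞ (W k)) :
    ContDiff ℝ ∞ (fun p : (Fin N → ℝ) × Cd d => slopeC b W p.1 p.2) := by
  have h : ContDiff ℝ ∞ (fun p : (Fin N → ℝ) × Cd d => b • p.2 + pert W p.1 p.2) :=
    (contDiff_snd.const_smul b).add (contDiff_pert hW)
  have h1 := (prim d).contDiff.comp h
  have h2 := (prim d).contDiff.comp h1
  exact ((contDiff_const.add ((evalTop d).contDiff.comp h2)).div_const d).sub
    ((evalTop d).contDiff.comp h1)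

theorem isStreamSolution_iff {b : ℝ} (hβ : phi (b • (1 : Cd d)) (topPt d) ≠ 0)
    {W : Fin N → C(ℝ, ℝ)} {δ : Fin N → ℝ} {Uδ : Cd d}
    (hU : ∀ V : Cd d, V = linStream d b + dirichletInv d b (pert W δ V) ↔ V = Uδ) :
    IsStreamSolution (perturbedVorticity b (fun k => W k) δ) d (extC Uδ) ∧
    (∀ u' : ℝ → ℝ, IsStreamSolution (perturbedVorticity b (fun k => W k) δ) d u' →
      EqOn u' (extC Uδ) (Icc 0 d)) ∧
    surfaceSlope d (extC Uδ) = slopeC b W δ Uδ := by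
  rw [← coe_vorticityC]
  obtain ⟨h1, a, ha⟩ := (integral_eq_iff hβ Uδ (pert W δ Uδ)).2 ((hU Uδ).2 rfl)
  have h2 := isStreamSolution_of_integral_eq (om := vorticityC b W δ) (a := a)
    (by rw [vorticityC_comp]; exact ha) h1
  refine ⟨h2.1, fun u' hu' z hz => ?_, ?_⟩
  · obtain ⟨V, hV, hV1, c, hc⟩ := hu'.exists_integral_eq
    rw [vorticityC_comp] at hc
    have := (hU V).1 ((integral_eq_iff hβ V (pert W δ V)).1 ⟨hV1, c, hc⟩)
    rw [extC_mem _ hz, ← this]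
    exact (hV ⟨z, hz⟩).symm
  · rw [h2.2, vorticityC_comp, slopeC_eq ha h1]

end Stream

/-! ### Persistence of simple zeros. -/

section Branches

/-- Persistence of simple zeros: if `F(0,·)` has on `(-∞,0]` exactly the simple zeros
`m₁ < ⋯ < m_N < 0`, then for small `δ` the negative zeros of `F(δ,·)` are given by `N` smooth
functions of `δ`. -/
theorem exists_smooth_zeros {E : Type*} [NormedAddCommGroup E] [NormedSpace ℝ E] [CompleteSpace E]
    {N : ℕ} {F : E × ℝ → ℝ} {m : Fin N → ℝ} {c : Fin N → ℝ} {R : ℝ}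
    (hF : ∀ μ, ∀ᶠ p in 𝓝 ((0 : E), μ), ContDiffAt ℝ ∞ F p)
    (hm : StrictMono m) (hmneg : ∀ l, m l < 0)
    (hzero : ∀ l, F (0, m l) = 0) (hzero' : ∀ μ ≤ 0, F (0, μ) = 0 → ∃ l, μ = m l)
    (hc : ∀ l, HasDerivAt (fun μ => F (0, μ)) (c l) (m l)) (hc0 : ∀ l, c l ≠ 0)
    (hR : ∀ᶠ δ in 𝓝 (0 : E), ∀ μ < -R, F (δ, μ) ≠ 0) :
    ∃ T : E → Fin N → ℝ, T 0 = m ∧ (∀ᶠ δ in 𝓝 0, ContDiffAt ℝ ∞ T δ) ∧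
      ∀ᶠ δ in 𝓝 0, StrictMono (T δ) ∧ range (T δ) = {μ | μ < 0 ∧ F (δ, μ) = 0} := by
  have hg : ∀ l, ∃ g : E → ℝ, g 0 = m l ∧ (∀ᶠ x in 𝓝 0, ContDiffAt ℝ ∞ g x) ∧
      ∀ᶠ p in 𝓝 (0, m l), F p = 0 ↔ p.2 = g p.1 := fun l =>
    exists_implicit_contDiffAt (hzero l) (hF (m l))
      (L := ContinuousLinearEquiv.unitsEquivAut ℝ (Units.mk0 (c l) (hc0 l)))
      ((hc l).hasFDerivAt_equiv (hc0 l))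
  choose g hg0 hgs hge using hg
  have hgc : ∀ l, ContinuousAt (g l) 0 := fun l => (hgs l).self_of_nhds.continuousAt
  have hg0' : ∀ l, Tendsto (g l) (𝓝 0) (𝓝 (m l)) := fun l => by
    rw [← hg0 l]; exact hgc l
  refine ⟨fun δ l => g l δ, funext hg0, ?_, ?_⟩
  · filter_upwards [eventually_all.2 hgs] with δ hδ
    exact contDiffAt_pi.2 hδ
  have h1 : ∀ᶠ δ in 𝓝 0, ∀ l, g l δ < 0 :=
    eventually_all.2 fun l => (hg0' l).eventually (gt_mem_nhds (hmneg l))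
  have h2 : ∀ᶠ δ in 𝓝 0, ∀ l, F (δ, g l δ) = 0 := by
    refine eventually_all.2 fun l => ?_
    have ht : Tendsto (fun δ => (δ, g l δ)) (𝓝 0) (𝓝 (0, m l)) := by
      rw [← hg0 l]
      exact continuousAt_id.prodMk (hgc l)
    filter_upwards [ht.eventually (hge l)] with δ hδ
    exact hδ.2 rfl
  have h3 : ∀ᶠ δ in 𝓝 0, ∀ i j : Fin N, i < j → g i δ < g j δ := by
    refine eventually_all.2 fun i => eventually_all.2 fun j => ?_
    by_cases hij : i < j
    · filter_upwards [(hg0' i).eventually_lt (hg0' j) (hm hij)] with δ hδ _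
      exact hδ
    · exact Eventually.of_forall fun δ h => absurd h hij
  -- Local statements are combined by compactness of `[-R, 0]`: near a zero the implicit function
  -- describes all zeros, elsewhere `F` stays nonzero. The right end point `0` is not a zero because
  -- all `m l` are negative.
  have h4 : ∀ᶠ δ in 𝓝 (0 : E), ∀ μ ∈ Icc (-R) 0, F (δ, μ) = 0 → ∃ l, μ = g l δ := by
    refine isCompact_Icc.eventually_forall_of_forall_eventually fun μ hμ => ?_
    by_cases hz : F (0, μ) = 0
    · obtain ⟨l, rfl⟩ := hzero' μ hμ.2 hz
      filter_upwards [hge l] with p hp h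
      exact ⟨l, hp.1 h⟩
    · have hcF : ContinuousAt F (0, μ) := (hF μ).self_of_nhds.continuousAt
      filter_upwards [hcF.eventually_ne hz] with p hp h
      exact absurd h hp
  filter_upwards [h1, h2, h3, h4, hR] with δ k1 k2 k3 k4 k5
  refine ⟨fun i j hij => k3 i j hij, ?_⟩
  ext μ
  constructor
  · rintro ⟨l, rfl⟩
    exact ⟨k1 l, k2 l⟩
  · rintro ⟨hμ, hFμ⟩
    have hμR : -R ≤ μ := by
      by_contra hlt
      exact k5 μ (not_le.1 hlt) hFμ
    obtain ⟨l, hl⟩ := k4 μ ⟨hμR, hμ.le⟩ hFμ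
    exact ⟨l, hl.symm⟩

end Branches

/-! ### The characteristic function: absence of very negative zeros and its derivative. -/

section Characteristic

variable {d : ℝ} [hd : Fact (0 < d)]

theorem prim_top_pos {f : Cd d} (h : ∀ z, 0 ≤ f z) {z₀ : Icc (0 : ℝ) d} (h0 : 0 < f z₀) :
    0 < prim d f (topPt d) := by
  rw [prim_apply]
  refine intervalIntegral.integral_pos hd.out (continuous_extC f).continuousOn
    (fun x _ => h _) ⟨z₀, z₀.2, ?_⟩
  rwa [extC_coe]

/-- The characteristic function has no zeros for very negative potentials. -/
theorem psi_sub_mul_phi_ne_zero {q : Cd d} {k κ : ℝ} (hk : κ ≤ k) (hq : ∀ z, q z ≤ -k ^ 2) :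
    psi q (topPt d) - κ * phi q (topPt d) ≠ 0 := by
  intro h
  -- The function φψ - kφ² vanishes at the bottom and has derivative (ψ - kφ)² + (-q - k²)φ² ≥ 0,
  -- which equals 1 at the bottom. So it is positive at the surface, whereas ψ = κφ makes it (κ -
  -- k)φ² ≤ 0 there.
  have hE := eq_const_add_prim (f := phi q * psi q - k • (phi q * phi q))
    (g := (psi q - k • phi q) * (psi q - k • phi q) + (-q - (k ^ 2) • 1) * (phi q * phi q))
    (fun z hz => by
      have h1 := hasDerivWithinAt_phi q hz
      have h2 := hasDerivWithinAt_psi q hz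
      refine ((h1.mul h2).sub ((h1.mul h1).const_mul k)).congr_deriv ?_
      change _ = (extC (psi q) z - k * extC (phi q) z) * (extC (psi q) z - k * extC (phi q) z)
        + (-extC q z - k ^ 2 * 1) * (extC (phi q) z * extC (phi q) z)
      ring)
  have hpos : 0 < prim d ((psi q - k • phi q) * (psi q - k • phi q)
      + (-q - (k ^ 2) • 1) * (phi q * phi q)) (topPt d) := by
    refine prim_top_pos (z₀ := botPt d) (fun z => ?_) ?_
    · have := hq z
      simp only [ContinuousMap.add_apply, ContinuousMap.mul_apply, ContinuousMap.sub_apply,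
        ContinuousMap.smul_apply, ContinuousMap.neg_apply, ContinuousMap.one_apply, smul_eq_mul]
      exact add_nonneg (mul_self_nonneg _) (mul_nonneg (by linarith) (mul_self_nonneg _))
    · simp
  have h3 := congrArg (fun f : Cd d => f (topPt d)) hE
  simp only [ContinuousMap.add_apply, ContinuousMap.mul_apply, ContinuousMap.sub_apply,
    ContinuousMap.smul_apply, smul_eq_mul, phi_bot, psi_bot] at h3 hpos
  have h4 : psi q (topPt d) = κ * phi q (topPt d) := by linarith
  rw [h4] at h3
  nlinarith [mul_nonneg (sub_nonneg.2 hk) (mul_self_nonneg (phi q (topPt d)))]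

/-- In particular `phi` and `psi` have no common zero, so `phi` does not vanish at the surface when
the characteristic function does. -/
theorem energy_const (l : ℝ) (z : Icc (0 : ℝ) d) :
    psi (l • (1 : Cd d)) z ^ 2 + l * phi (l • (1 : Cd d)) z ^ 2 = 1 := by
  set q : Cd d := l • 1 with hq
  have hE := eq_const_add_prim (f := psi q * psi q + l • (phi q * phi q)) (g := 0)
    (fun z hz => by
      have h1 := hasDerivWithinAt_phi q hz
      have h2 := hasDerivWithinAt_psi q hz
      refine ((h2.mul h2).add ((h1.mul h1).const_mul l)).congr_deriv ?_
      have : extC q z = l * 1 := rfl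
      rw [this]
      change _ = (0 : ℝ)
      ring)
  have h3 := congrArg (fun f : Cd d => f z) hE
  simp only [ContinuousMap.add_apply, ContinuousMap.mul_apply,
    ContinuousMap.smul_apply, smul_eq_mul, phi_bot, psi_bot, map_zero, ContinuousMap.one_apply,
    ContinuousMap.zero_apply] at h3
  linarith

theorem prim_phi_mul_phi_pos (q : Cd d) : 0 < prim d (phi q * phi q) (topPt d) := by
  have : ∃ z, phi q z ≠ 0 := by
    by_contra! hcon
    have h0 : phi q = 0 := ContinuousMap.ext hcon
    have h1 := phi_eq q
    have h2 : psi q = 1 := by rw [psi, h0]; simp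
    rw [h0, h2, prim_one] at h1
    have := congrArg (fun f : Cd d => f (topPt d)) h1
    exact hd.out.ne this
  obtain ⟨z, hz⟩ := this
  exact prim_top_pos (fun z => mul_self_nonneg _) (mul_self_pos.2 hz)

/-- The derivative of the solution `phi` along a curve of potentials. -/
theorem exists_hasDerivAt_phi_psi {q : ℝ → Cd d} {q' : Cd d} {t : ℝ} (hq : HasDerivAt q q' t) :
    ∃ φ' ψ' : Cd d, HasDerivAt (fun s => phi (q s)) φ' t ∧ HasDerivAt (fun s => psi (q s)) ψ' t ∧
      phi (q t) (topPt d) * ψ' (topPt d) - φ' (topPt d) * psi (q t) (topPt d)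
        = -prim d (q' * (phi (q t) * phi (q t))) (topPt d) := by
  have hφ : DifferentiableAt ℝ (phi : Cd d → Cd d) (q t) :=
    contDiff_phi.contDiffAt.differentiableAt (by simp)
  obtain ⟨φ', hφ'⟩ : ∃ φ', HasDerivAt (fun s => phi (q s)) φ' t :=
    ⟨_, hφ.hasFDerivAt.comp_hasDerivAt t hq⟩
  have hprod : HasDerivAt (fun s => q s * phi (q s)) (q' * phi (q t) + q t * φ') t := hq.mul hφ'
  set ψ' : Cd d := -prim d (q' * phi (q t) + q t * φ') with hψ'
  have hψ : HasDerivAt (fun s => psi (q s)) ψ' t :=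
    ((prim d).hasFDerivAt.comp_hasDerivAt t hprod).const_sub 1
  have hrel : φ' = prim d ψ' := by
    have h1 := (prim d).hasFDerivAt.comp_hasDerivAt t hψ
    refine hφ'.unique (h1.congr_of_eventuallyEq (Eventually.of_forall fun s => ?_))
    exact phi_eq (q s)
  refine ⟨φ', ψ', hφ', hψ, ?_⟩
  -- The variation solves the inhomogeneous equation with source `-q' φ` and zero initial slope,
  -- hence `a' = 0`.
  rw [green_identity (φ := phi (q t)) (ψ := psi (q t)) (g := q t * phi (q t)) (a := 1)
    (φ' := φ') (ψ' := ψ') (g' := q' * phi (q t) + q t * φ') (a' := 0)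
    (phi_eq _) (by rw [psi, one_smul]) hrel (by rw [zero_smul, zero_sub])]
  have : φ' * (q t * phi (q t)) - phi (q t) * (q' * phi (q t) + q t * φ')
      = -(q' * (phi (q t) * phi (q t))) := by ring
  rw [this, map_neg]
  rfl

/-- The derivative of the characteristic function along a curve, at a zero. -/
theorem hasDerivAt_charFun {q : ℝ → Cd d} {q' : Cd d} {κ : ℝ → ℝ} {κ' t : ℝ}
    (hq : HasDerivAt q q' t) (hκ : HasDerivAt κ κ' t)
    (h0 : psi (q t) (topPt d) - κ t * phi (q t) (topPt d) = 0)
    (hne : phi (q t) (topPt d) ≠ 0) :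
    HasDerivAt (fun s => psi (q s) (topPt d) - κ s * phi (q s) (topPt d))
      (-(prim d (q' * (phi (q t) * phi (q t))) (topPt d) + κ' * phi (q t) (topPt d) ^ 2)
        / phi (q t) (topPt d)) t := by
  obtain ⟨φ', ψ', h1, h2, h3⟩ := exists_hasDerivAt_phi_psi hq
  have e1 : HasDerivAt (fun s => phi (q s) (topPt d)) (φ' (topPt d)) t :=
    (evalTop d).hasFDerivAt.comp_hasDerivAt t h1
  have e2 : HasDerivAt (fun s => psi (q s) (topPt d)) (ψ' (topPt d)) t :=
    (evalTop d).hasFDerivAt.comp_hasDerivAt t h2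
  refine (e2.sub (hκ.mul e1)).congr_deriv ?_
  rw [eq_div_iff hne]
  -- At a zero ψ = κφ, so the combination in Green's identity is φ(d) times ψ' - κφ', where primes
  -- are parameter derivatives.
  have h4 : psi (q t) (topPt d) = κ t * phi (q t) (topPt d) := by linarith
  rw [h4] at h3
  linear_combination h3

end Characteristic

/-! ### The map from `δ` to the negative eigenvalues and its partial derivatives at 0. -/

section SpectrumMap

variable {d : ℝ} {N : ℕ}

theorem pert_smul_single (W : Fin N → C(ℝ, ℝ)) (j : Fin N) (t : ℝ) (u : Cd d) :
    pert W (t • Pi.single j 1) u = t • (W j).comp u := by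
  rw [pert, Finset.sum_eq_single j]
  · simp
  · intro k _ hk
    simp [hk]
  · simp

theorem hasDerivAt_pert {W : Fin N → C(ℝ, ℝ)} (hW : ∀ k, ContDiff ℝ ∞ (W k)) (j : Fin N)
    {u : ℝ → Cd d} (hu : DifferentiableAt ℝ u 0) :
    HasDerivAt (fun t : ℝ => pert W (t • Pi.single j 1) (u t)) ((W j).comp (u 0)) 0 := by
  simp only [pert_smul_single]
  have h1 : DifferentiableAt ℝ (fun t => (W j).comp (u t)) 0 :=
    ((contDiff_continuousMap_comp (hW j)).contDiffAt.differentiableAt (by simp)).comp 0 hu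
  have := (hasDerivAt_id (0 : ℝ)).smul h1.hasDerivAt
  simp only [id_eq, zero_smul, one_smul, zero_add] at this
  exact this

theorem ContDiffAt.pert_comp {W : Fin N → C(ℝ, ℝ)} (hW : ∀ k, ContDiff ℝ ∞ (W k))
    {U : (Fin N → ℝ) → Cd d} {δ : Fin N → ℝ} (hU : ContDiffAt ℝ ∞ U δ) :
    ContDiffAt ℝ ∞ (fun δ => pert W δ (U δ)) δ := by
  have h : ContDiffAt ℝ ∞ (fun δ => (δ, U δ)) δ := contDiffAt_id.prodMk hU
  exact ContDiffAt.comp (g := fun p : (Fin N → ℝ) × Cd d => pert W p.1 p.2) δ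
    (contDiff_pert hW).contDiffAt h

variable [hd : Fact (0 < d)]

theorem ContDiffAt.slopeC_comp (b : ℝ) {W : Fin N → C(ℝ, ℝ)} (hW : ∀ k, ContDiff ℝ ∞ (W k))
    {U : (Fin N → ℝ) → Cd d} {δ : Fin N → ℝ} (hU : ContDiffAt ℝ ∞ U δ) :
    ContDiffAt ℝ ∞ (fun δ => slopeC b W δ (U δ)) δ := by
  have h : ContDiffAt ℝ ∞ (fun δ => (δ, U δ)) δ := contDiffAt_id.prodMk hU
  have h2 := (contDiff_slopeC (d := d) b hW).contDiffAt (x := (δ, U δ))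
  have h3 := ContDiffAt.comp δ h2 h
  exact h3

/-- The surface slope of the linear stream solution. -/
def linSlope (d : ℝ) [Fact (0 < d)] (b : ℝ) : ℝ :=
  (phi (b • (1 : Cd d)) (topPt d))⁻¹ * psi (b • (1 : Cd d)) (topPt d)

/-- `κ` for the linear vorticity. -/
def linKappa (d : ℝ) [Fact (0 < d)] (b : ℝ) : ℝ := 1 / linSlope d b ^ 2 - b / linSlope d b

theorem linStream_eq (b : ℝ) :
    linStream d b = prim d ((phi (b • (1 : Cd d)) (topPt d))⁻¹ • psi (b • (1 : Cd d))) := by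
  rw [linStream, map_smul, ← phi_eq]

/-- This is the form of the linear stream solution that `green_identity` requires. -/
theorem smul_psi_eq (b : ℝ) :
    (phi (b • (1 : Cd d)) (topPt d))⁻¹ • psi (b • (1 : Cd d))
      = (phi (b • (1 : Cd d)) (topPt d))⁻¹ • 1 - prim d (b • linStream d b) := by
  rw [psi, smul_sub, ← map_smul, linStream, smul_mul_assoc, one_mul, smul_comm]

theorem linStream_integral_eq (b : ℝ) :
    linStream d b = (phi (b • (1 : Cd d)) (topPt d))⁻¹ • coordC d
      - prim d (prim d (b • linStream d b)) := by
  conv_lhs => rw [linStream_eq, smul_psi_eq, map_sub, map_smul, prim_one]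

theorem slopeC_zero {b : ℝ} (hβ : phi (b • (1 : Cd d)) (topPt d) ≠ 0) (W : Fin N → C(ℝ, ℝ)) :
    slopeC b W 0 (linStream d b) = linSlope d b := by
  have hp : pert W 0 (linStream d b) = 0 := by simp [pert]
  rw [slopeC_eq (a := (phi (b • (1 : Cd d)) (topPt d))⁻¹)
    (by rw [hp, add_zero]; exact linStream_integral_eq b) (inv_mul_cancel₀ hβ), hp, add_zero]
  have := congrArg (fun f : Cd d => f (topPt d)) (smul_psi_eq (d := d) b)
  simpa [linSlope] using this.symm

theorem deriv_perturbedVorticity {b : ℝ} {W W' : Fin N → C(ℝ, ℝ)}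
    (hW' : ∀ k x, HasDerivAt (W k) (W' k x) x) (δ : Fin N → ℝ) (x : ℝ) :
    deriv (perturbedVorticity b (fun k => W k) δ) x = b + ∑ k, δ k * W' k x := by
  have h : HasDerivAt (perturbedVorticity b (fun k => W k) δ) (b * 1 + ∑ k, δ k * W' k x) x :=
    ((hasDerivAt_id x).const_mul b).add
      (HasDerivAt.fun_sum fun k _ => (hW' k x).const_mul (δ k))
  rw [h.deriv, mul_one]

/-- The derivative of the surface slope in the direction of the `j`-th perturbation. -/
theorem hasDerivAt_slopeC {b : ℝ} (hβ : phi (b • (1 : Cd d)) (topPt d) ≠ 0)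
    {W : Fin N → C(ℝ, ℝ)} (hW : ∀ k, ContDiff ℝ ∞ (W k)) (j : Fin N) {u : ℝ → Cd d}
    (hu : DifferentiableAt ℝ u 0) (hu0 : u 0 = linStream d b)
    (heq : ∀ᶠ t in 𝓝 0, u t = linStream d b
      + dirichletInv d b (pert W (t • Pi.single j 1) (u t))) :
    HasDerivAt (fun t : ℝ => slopeC b W (t • Pi.single j 1) (u t))
      (-prim d (linStream d b * (W j).comp (linStream d b)) (topPt d)) 0 := by
  have hp := hasDerivAt_pert hW j hu
  rw [hu0] at hp
  set u' := deriv u 0 with hu'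
  have hud : HasDerivAt u u' 0 := hu.hasDerivAt
  set η : Cd d := b • u' + (W j).comp (linStream d b) with hη
  have hom : HasDerivAt (fun t : ℝ => b • u t + pert W (t • Pi.single j 1) (u t)) η 0 :=
    (hud.const_smul b).add hp
  have hp1 : HasDerivAt (fun t : ℝ => prim d (b • u t + pert W (t • Pi.single j 1) (u t)))
      (prim d η) 0 := (prim d).hasFDerivAt.comp_hasDerivAt 0 hom
  have hp2 : HasDerivAt (fun t : ℝ => prim d (prim d (b • u t
      + pert W (t • Pi.single j 1) (u t)))) (prim d (prim d η)) 0 :=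
    (prim d).hasFDerivAt.comp_hasDerivAt 0 hp1
  have he1 : HasDerivAt (fun t : ℝ => prim d (b • u t + pert W (t • Pi.single j 1) (u t))
      (topPt d)) (prim d η (topPt d)) 0 := (evalTop d).hasFDerivAt.comp_hasDerivAt 0 hp1
  have he2 : HasDerivAt (fun t : ℝ => prim d (prim d (b • u t
      + pert W (t • Pi.single j 1) (u t))) (topPt d)) (prim d (prim d η) (topPt d)) 0 :=
    (evalTop d).hasFDerivAt.comp_hasDerivAt 0 hp2
  have hdd := hd.out.ne'
  have ha := (he2.const_add 1).div_const d
  set a' := prim d (prim d η) (topPt d) / d with ha'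
  -- Differentiating the integral equation shows that `u'`, the derivative in `t`, solves the
  -- linearized problem. It vanishes at both ends, so Green's identity with `linStream` isolates the
  -- variation of the slope.
  have hu'eq : u' = a' • coordC d - prim d (prim d η) := by
    have h1 := (ha.smul_const (coordC d)).sub hp2
    refine hud.unique (h1.congr_of_eventuallyEq ?_)
    filter_upwards [heq] with t ht
    obtain ⟨k1, a, k2⟩ := (integral_eq_iff hβ (u t) _).2 ht
    have h2 := congrArg (fun f : Cd d => f (topPt d)) k2
    have hc : coordC d (topPt d) = d := rfl
    simp only [k1, ContinuousMap.sub_apply, ContinuousMap.smul_apply, smul_eq_mul, hc] at h2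
    have h3 : (1 + prim d (prim d (b • u t + pert W (t • Pi.single j 1) (u t))) (topPt d)) / d
        = a := by
      field_simp
      linarith
    simp only [Pi.sub_apply, h3]
    exact k2
  have hc : coordC d (topPt d) = d := rfl
  have htop : u' (topPt d) = 0 := by
    rw [hu'eq]
    simp only [ContinuousMap.sub_apply, ContinuousMap.smul_apply, smul_eq_mul, hc, ha']
    field_simp
    ring
  have hgreen := green_identity (linStream_eq (d := d) b) (smul_psi_eq b)
    (φ' := u') (ψ' := a' • 1 - prim d η) (g' := η) (a' := a')
    (by rw [map_sub, map_smul, prim_one]; exact hu'eq) rfl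
  have hl1 : linStream d b (topPt d) = 1 := inv_mul_cancel₀ hβ
  rw [htop, hl1] at hgreen
  have hsimp : u' * b • linStream d b - linStream d b * η
      = -(linStream d b * (W j).comp (linStream d b)) := by
    rw [hη, mul_add, mul_smul_comm, mul_smul_comm, mul_comm u']
    abel
  rw [hsimp, map_neg] at hgreen
  refine (ha.sub he1).congr_deriv ?_
  simpa using hgreen

/-- The spectrum map of the perturbed problem, with its derivative at `0`. -/
theorem exists_spectrumMap {b : ℝ} (hβ : phi (b • (1 : Cd d)) (topPt d) ≠ 0)
    (hσ : linSlope d b ≠ 0) {W W' : Fin N → C(ℝ, ℝ)} (hW : ∀ k, ContDiff ℝ ∞ (W k))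
    (hW's : ∀ k, ContDiff ℝ ∞ (W' k)) (hW' : ∀ k x, HasDerivAt (W k) (W' k x) x)
    (hW1 : ∀ k, W k 1 = 0) {C : ℝ} (hC : 0 ≤ C) (hL : ∀ k x y, |W k x - W k y| ≤ C * |x - y|)
    {m : Fin N → ℝ} (hm : StrictMono m) (hmneg : ∀ l, m l < 0)
    (hzero : ∀ μ ≤ 0, psi ((b + μ) • (1 : Cd d)) (topPt d)
      - linKappa d b * phi ((b + μ) • (1 : Cd d)) (topPt d) = 0 ↔ ∃ l, μ = m l) :
    ∃ T : (Fin N → ℝ) → Fin N → ℝ, (∀ᶠ δ in 𝓝 0, ContDiffAt ℝ ∞ T δ) ∧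
      IsNegativeSpectrumMap b d (fun k => W k) T ∧
      ∀ l j, HasDerivAt (fun t : ℝ => T (t • Pi.single j 1) l)
        (-(prim d ((W' j).comp (linStream d b) * (phi ((b + m l) • (1 : Cd d))
            * phi ((b + m l) • (1 : Cd d)))) (topPt d)
          + (-2 / linSlope d b ^ 3 + b / linSlope d b ^ 2)
            * -prim d (linStream d b * (W j).comp (linStream d b)) (topPt d)
            * phi ((b + m l) • (1 : Cd d)) (topPt d) ^ 2)
          / prim d (phi ((b + m l) • (1 : Cd d)) * phi ((b + m l) • (1 : Cd d))) (topPt d)) 0 := by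
  obtain ⟨U, hU0, hUs, hUe⟩ := exists_stream_family (d := d) b hW hC hL
  set σ : (Fin N → ℝ) → ℝ := fun δ => slopeC b W δ (U δ) with hσdef
  have hσ0 : σ 0 = linSlope d b := by rw [hσdef]; simp only [hU0, slopeC_zero hβ]
  have hσs : ∀ᶠ δ in 𝓝 0, ContDiffAt ℝ ∞ σ δ := by
    filter_upwards [hUs] with δ hδ
    exact hδ.slopeC_comp b hW
  have hσne : ∀ᶠ δ in 𝓝 0, σ δ ≠ 0 :=
    hσs.self_of_nhds.continuousAt.eventually_ne (by rwa [hσ0])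
  set κ : (Fin N → ℝ) → ℝ := fun δ => 1 / σ δ ^ 2 - b / σ δ with hκdef
  have hκ0 : κ 0 = linKappa d b := by simp only [hκdef, hσ0, linKappa]
  have hκs : ∀ᶠ δ in 𝓝 0, ContDiffAt ℝ ∞ κ δ := by
    filter_upwards [hσs, hσne] with δ h1 h2
    exact (contDiffAt_const.div (h1.pow 2) (pow_ne_zero 2 h2)).sub (contDiffAt_const.div h1 h2)
  set P : (Fin N → ℝ) → Cd d := fun δ => pert W' δ (U δ) with hPdef
  have hP0 : P 0 = 0 := by simp [hPdef, pert]
  have hPs : ∀ᶠ δ in 𝓝 0, ContDiffAt ℝ ∞ P δ := by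
    filter_upwards [hUs] with δ hδ
    exact hδ.pert_comp hW's
  set Q : (Fin N → ℝ) × ℝ → Cd d := fun p => (b + p.2) • (1 : Cd d) + P p.1 with hQdef
  set F : (Fin N → ℝ) × ℝ → ℝ := fun p =>
    psi (Q p) (topPt d) - κ p.1 * phi (Q p) (topPt d) with hFdef
  have hQ0 : ∀ μ, Q (0, μ) = (b + μ) • (1 : Cd d) := fun μ => by simp [hQdef, hP0]
  have hFs : ∀ μ, ∀ᶠ p in 𝓝 ((0 : Fin N → ℝ), μ), ContDiffAt ℝ ∞ F p := by
    intro μ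
    have ht : Tendsto (fun p : (Fin N → ℝ) × ℝ => p.1) (𝓝 (0, μ)) (𝓝 0) :=
      continuous_fst.tendsto _
    filter_upwards [ht.eventually hPs, ht.eventually hκs] with p h1 h2
    have hQp : ContDiffAt ℝ ∞ Q p :=
      ((contDiffAt_const.add contDiffAt_snd).smul contDiffAt_const).add (h1.comp p contDiffAt_fst)
    have e1 : ContDiffAt ℝ ∞ (fun p => phi (Q p) (topPt d)) p :=
      (evalTop d).contDiff.contDiffAt.comp p (contDiff_phi.contDiffAt.comp p hQp)
    have e2 : ContDiffAt ℝ ∞ (fun p => psi (Q p) (topPt d)) p :=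
      (evalTop d).contDiff.contDiffAt.comp p (contDiff_psi.contDiffAt.comp p hQp)
    exact e2.sub ((h2.comp p contDiffAt_fst).mul e1)
  have hF0 : ∀ μ, F (0, μ) = psi ((b + μ) • (1 : Cd d)) (topPt d)
      - linKappa d b * phi ((b + μ) • (1 : Cd d)) (topPt d) := fun μ => by
    simp only [hFdef, hQ0, hκ0]
  have hFm : ∀ l, F (0, m l) = 0 := fun l => by
    rw [hF0]
    exact (hzero (m l) (hmneg l).le).2 ⟨l, rfl⟩
  have hφne : ∀ l, phi ((b + m l) • (1 : Cd d)) (topPt d) ≠ 0 := by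
    intro l h
    have h1 := hFm l
    rw [hF0, h, mul_zero, sub_zero] at h1
    have h2 := energy_const (d := d) (b + m l) (topPt d)
    rw [h, h1] at h2
    norm_num at h2
  have hval : ∀ l, 0 < prim d (phi ((b + m l) • (1 : Cd d)) * phi ((b + m l) • (1 : Cd d)))
      (topPt d) := fun l => prim_phi_mul_phi_pos _
  have hFd : ∀ l, HasDerivAt (fun μ => F (0, μ))
      (-prim d (phi ((b + m l) • (1 : Cd d)) * phi ((b + m l) • (1 : Cd d))) (topPt d)
        / phi ((b + m l) • (1 : Cd d)) (topPt d)) (m l) := by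
    intro l
    have hq : HasDerivAt (fun μ : ℝ => (b + μ) • (1 : Cd d)) ((1 : ℝ) • (1 : Cd d)) (m l) := by
      have h := HasDerivAt.smul_const ((hasDerivAt_id (m l)).const_add b) (1 : Cd d)
      exact h
    have h1 := hasDerivAt_charFun hq (hasDerivAt_const (m l) (linKappa d b))
      (by rw [← hF0]; exact hFm l) (hφne l)
    simp only [one_smul, one_mul, zero_mul, add_zero] at h1
    simp only [hF0]
    exact h1
  -- With `k = |linKappa d b| + 1` and `‖P δ‖ < 1`, this bound on `μ` makes the potential `b + μ + P
  -- δ` at most `-k²`.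
  have hR : ∀ᶠ δ in 𝓝 (0 : Fin N → ℝ), ∀ μ < -((|linKappa d b| + 1) ^ 2 + b + 1),
      F (δ, μ) ≠ 0 := by
    have e1 : ∀ᶠ δ in 𝓝 (0 : Fin N → ℝ), κ δ < |linKappa d b| + 1 := by
      refine hκs.self_of_nhds.continuousAt.eventually_lt continuousAt_const ?_
      rw [hκ0]
      linarith [le_abs_self (linKappa d b)]
    have e2 : ∀ᶠ δ in 𝓝 (0 : Fin N → ℝ), ‖P δ‖ < 1 := by
      refine hPs.self_of_nhds.continuousAt.norm.eventually_lt continuousAt_const ?_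
      rw [hP0]; simp
    filter_upwards [e1, e2] with δ k1 k2 μ hμ
    refine psi_sub_mul_phi_ne_zero k1.le fun z => ?_
    have h3 : P δ z ≤ 1 := (le_abs_self _).trans (((P δ).norm_coe_le_norm z).trans k2.le)
    change (b + μ) * 1 + P δ z ≤ _
    linarith
  obtain ⟨T, hT0, hTs, hTe⟩ := exists_smooth_zeros (F := F) hFs hm hmneg hFm
    (fun μ hμ h => (hzero μ hμ).1 (by rw [← hF0]; exact h)) hFd
    (fun l => div_ne_zero (neg_ne_zero.2 (hval l).ne') (hφne l)) hR
  refine ⟨T, hTs, ?_, ?_⟩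
  · filter_upwards [hUe, hσne, hTe] with δ h1 h2 h3
    obtain ⟨k1, k2, k3⟩ := isStreamSolution_iff hβ h1
    refine ⟨extC (U δ), k1, k2, by rw [k3]; exact h2, h3.1, ?_⟩
    rw [h3.2]
    have hkap : kappa (perturbedVorticity b (fun k => W k) δ) d (extC (U δ)) = κ δ := by
      rw [kappa, k3]
      -- The perturbations vanish at 1, so `κ` depends on `δ` through the slope alone.
      have : perturbedVorticity b (fun k => W k) δ 1 = b := by
        simp [perturbedVorticity, hW1]
      rw [this]
    ext μ
    refine and_congr_right fun _ => ?_
    rw [isSLEigenvalue_iff (q := Q (δ, μ)), hkap]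
    intro z
    rw [deriv_perturbedVorticity hW', extC_coe]
    simp only [hQdef, hPdef, pert, ContinuousMap.add_apply, ContinuousMap.smul_apply,
      ContinuousMap.one_apply, ContinuousMap.sum_apply, ContinuousMap.comp_apply, smul_eq_mul]
    ring
  · intro l j
    have hline : HasDerivAt (fun t : ℝ => t • (Pi.single j 1 : Fin N → ℝ)) (Pi.single j 1) 0 := by
      simpa using (hasDerivAt_id (0 : ℝ)).smul_const (Pi.single j 1 : Fin N → ℝ)
    have hl0 : (0 : ℝ) • (Pi.single j 1 : Fin N → ℝ) = 0 := zero_smul _ _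
    have hlt : Tendsto (fun t : ℝ => t • (Pi.single j 1 : Fin N → ℝ)) (𝓝 0) (𝓝 0) := by
      have := hline.continuousAt.tendsto
      rwa [hl0] at this
    have hcomp : ∀ {Y : Type} [NormedAddCommGroup Y] [NormedSpace ℝ Y] {f : (Fin N → ℝ) → Y},
        ContDiffAt ℝ ∞ f 0 →
        DifferentiableAt ℝ (fun t : ℝ => f (t • (Pi.single j 1 : Fin N → ℝ))) 0 := by
      intro Y _ _ f hf
      have hfd : DifferentiableAt ℝ f ((0 : ℝ) • (Pi.single j 1 : Fin N → ℝ)) := by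
        rw [hl0]; exact hf.differentiableAt (by simp)
      exact hfd.comp 0 hline.differentiableAt
    have hud := hcomp hUs.self_of_nhds
    have hσd := hasDerivAt_slopeC hβ hW j hud (by rw [hl0, hU0]) (by
      filter_upwards [hlt.eventually hUe] with t ht
      exact (ht _).2 rfl)
    set s' := -prim d (linStream d b * (W j).comp (linStream d b)) (topPt d) with hs'
    change HasDerivAt (fun t : ℝ => σ (t • (Pi.single j 1 : Fin N → ℝ))) s' 0 at hσd
    have hκd : HasDerivAt (fun t : ℝ => κ (t • (Pi.single j 1 : Fin N → ℝ)))
        ((-2 / linSlope d b ^ 3 + b / linSlope d b ^ 2) * s') 0 := by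
      have hne : σ ((0 : ℝ) • (Pi.single j 1 : Fin N → ℝ)) ≠ 0 := by rwa [hl0, hσ0]
      have h1 := ((hasDerivAt_const (0 : ℝ) (1 : ℝ)).div (hσd.pow 2) (pow_ne_zero 2 hne)).sub
        ((hasDerivAt_const (0 : ℝ) b).div hσd hne)
      refine h1.congr_deriv ?_
      simp only [Pi.pow_apply, hl0, hσ0]
      field_simp
      ring
    have hPd := hasDerivAt_pert hW's j hud
    rw [hl0, hU0] at hPd
    have hTd : DifferentiableAt ℝ (fun t : ℝ => T (t • (Pi.single j 1 : Fin N → ℝ)) l) 0 :=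
      differentiableAt_pi.1 (hcomp hTs.self_of_nhds) l
    set μ' := deriv (fun t : ℝ => T (t • (Pi.single j 1 : Fin N → ℝ)) l) 0 with hμ'
    have hμd : HasDerivAt (fun t : ℝ => T (t • (Pi.single j 1 : Fin N → ℝ)) l) μ' 0 :=
      hTd.hasDerivAt
    set q : ℝ → Cd d := fun t => Q (t • Pi.single j 1, T (t • Pi.single j 1) l) with hq
    have hqd : HasDerivAt q (μ' • (1 : Cd d) + (W' j).comp (linStream d b)) 0 :=
      ((hμd.const_add b).smul_const _).add hPd
    have hq0 : q 0 = (b + m l) • (1 : Cd d) := by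
      simp only [hq, hl0, hT0, hQ0]
    have hzero0 : psi (q 0) (topPt d) - κ ((0 : ℝ) • (Pi.single j 1 : Fin N → ℝ))
        * phi (q 0) (topPt d) = 0 := by
      rw [hq0, hl0, hκ0, ← hF0]; exact hFm l
    have hchar := hasDerivAt_charFun hqd hκd hzero0 (by rw [hq0]; exact hφne l)
    -- The characteristic function vanishes identically along the branch. Its derivative, given by
    -- `hchar`, is therefore zero, and this is solved for `μ'`.
    have hconst : (fun t : ℝ => psi (q t) (topPt d) - κ (t • (Pi.single j 1 : Fin N → ℝ))
        * phi (q t) (topPt d)) =ᶠ[𝓝 0] fun _ => (0 : ℝ) := by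
      filter_upwards [hlt.eventually hTe] with t ht
      have : T (t • Pi.single j 1) l ∈ {μ | μ < 0 ∧ F (t • Pi.single j 1, μ) = 0} := by
        rw [← ht.2]; exact mem_range_self l
      exact this.2
    have hz := hchar.unique ((hasDerivAt_const (0 : ℝ) (0 : ℝ)).congr_of_eventuallyEq hconst)
    rw [hq0, div_eq_zero_iff, or_iff_left (hφne l), neg_eq_zero, add_mul, smul_mul_assoc, one_mul,
      map_add, map_smul] at hz
    simp only [ContinuousMap.add_apply, ContinuousMap.smul_apply, smul_eq_mul] at hz
    refine hμd.congr_deriv ?_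
    rw [eq_div_iff (hval l).ne']
    linarith

end SpectrumMap

/-! ### Sums over branches and the linear independence they satisfy. -/

section BranchSums

theorem sum_alternating_pow {K : Type*} [CommRing K] {x y : K} (hxy : x * y = 1) {e : ℕ}
    (he : e < 2) (k : ℕ) :
    (x ^ 2 - 1) * ∑ i ∈ Finset.range (2 * k + 1), (if Even i then x else y) ^ (i + e)
      = x ^ 2 * x ^ (2 * k + e) - x * y ^ (2 * k + e) + (-1) ^ e * (x - 1) := by
  induction k with
  | zero =>
    interval_cases e
    · simp
    · simp
      linear_combination hxy
  | succ k ih =>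
    have h1 : ¬ Even (2 * k + 1) := by simp
    have h2 : Even (2 * k + 1 + 1) := by simp [Nat.even_add_one]
    rw [show 2 * (k + 1) + 1 = 2 * k + 1 + 1 + 1 by ring, Finset.sum_range_succ,
      Finset.sum_range_succ, mul_add, mul_add, ih, if_neg h1, if_pos h2]
    have e1 : y ^ (2 * k + 1 + e) = y * y ^ (2 * k + e) := by ring
    have e2 : x ^ (2 * k + 1 + 1 + e) = x ^ 2 * x ^ (2 * k + e) := by ring
    have e3 : x ^ (2 * (k + 1) + e) = x ^ 2 * x ^ (2 * k + e) := by ring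
    have e4 : y ^ (2 * (k + 1) + e) = y ^ 2 * y ^ (2 * k + e) := by ring
    rw [e1, e2, e3, e4]
    linear_combination (x + y) * y ^ (2 * k + e) * hxy

/-- The two sums are the coefficients of exp(rτ) and exp(-rτ) in a branch sum. Their closed forms,
with the terms quadratic in x^(2k+e) eliminated, leave (x - 1)²(x + 1) = 0. -/
theorem sum_alternating_pow_ne_zero {x y : ℂ} (hxy : x * y = 1) {e : ℕ} (he : e < 2) (k : ℕ)
    (h1 : ∑ i ∈ Finset.range (2 * k + 1), (if Even i then x else y) ^ (i + e) = 0)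
    (h2 : ∑ i ∈ Finset.range (2 * k + 1), (if Even i then y else x) ^ (i + e) = 0) : False := by
  have k1 := sum_alternating_pow hxy he k
  have k2 := sum_alternating_pow ((mul_comm y x).trans hxy) he k
  rw [h1, mul_zero] at k1
  rw [h2, mul_zero] at k2
  have hQ : x ^ (2 * k + e) * y ^ (2 * k + e) = 1 := by rw [← mul_pow, hxy, one_pow]
  have hx0 : x ≠ 0 := left_ne_zero_of_mul_eq_one hxy
  have hε : ((-1 : ℂ) ^ e) ≠ 0 := pow_ne_zero _ (by norm_num)
  have hy : y = x⁻¹ := eq_inv_of_mul_eq_one_right hxy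
  have hprod : (-1 : ℂ) ^ e * x ^ (2 * k + e) * ((x - 1) ^ 2 * (x + 1)) = 0 := by
    set Q := x ^ (2 * k + e)
    set R := y ^ (2 * k + e)
    set ε := (-1 : ℂ) ^ e
    have t1 : x ^ 2 * Q * Q - x + ε * (x - 1) * Q = 0 := by
      linear_combination -Q * k1 + x * hQ
    have t2 : 1 - x * Q * Q + ε * (x - x ^ 2) * Q = 0 := by
      linear_combination -x ^ 2 * Q * k2 - x ^ 2 * y ^ 2 * hQ - (x * y + 1) * hxy
        + (x * Q * Q - ε * x * Q) * hxy
    linear_combination -t1 - x * t2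
  have hcases : x = 1 ∨ x = -1 := by
    rcases mul_eq_zero.1 hprod with h | h
    · exact absurd h (mul_ne_zero hε (pow_ne_zero _ hx0))
    · rcases mul_eq_zero.1 h with h | h
      · exact Or.inl (sub_eq_zero.1 (pow_eq_zero_iff (two_ne_zero)|>.1 h))
      · exact Or.inr (eq_neg_of_add_eq_zero_left h)
  -- For `x = 1` the sum is `2k + 1`. For `x = -1` it is ±1, having an odd number of alternating
  -- terms.
  rcases hcases with h | h
  · rw [h, inv_one] at hy
    rw [h, hy] at h1
    simp at h1
    have : ((2 * k + 1 : ℕ) : ℂ) = 0 := by push_cast; exact h1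
    exact absurd this (Nat.cast_ne_zero.2 (by omega))
  · have hy' : y = -1 := by rw [hy, h]; norm_num
    rw [h, hy'] at h1
    simp only [ite_self, pow_add, ← Finset.sum_mul] at h1
    rcases mul_eq_zero.1 h1 with h | h
    · rw [neg_one_geom_sum] at h
      simp at h
    · exact hε h

/-- The `i`-th branch `(i + e) h ± τ` of the points of a given level. -/
def branch (h : ℝ) (e i : ℕ) (τ : ℝ) : ℝ := (i + e) * h + (-1) ^ i * τ

/-- The sum of a function over the first `2 k + 1` branches. -/
def branchSum (h : ℝ) (e k : ℕ) (F : ℝ → ℝ) (τ : ℝ) : ℝ :=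
  ∑ i ∈ Finset.range (2 * k + 1), F (branch h e i τ)

theorem hasDerivAt_branch (h : ℝ) (e i : ℕ) (τ : ℝ) :
    HasDerivAt (branch h e i) ((-1) ^ i) τ := by
  have := ((hasDerivAt_id τ).const_mul ((-1 : ℝ) ^ i)).const_add ((i + e) * h)
  rw [mul_one] at this
  exact this

/-- If `Y'' = 2 - 4 l Y`, the branch sum `G` of `Y` satisfies `G'' = 2 (2 k + 1) - 4 l G`. -/
theorem exists_hasDerivAt_branchSum {Y Y' : ℝ → ℝ} {l : ℝ} (h1 : ∀ x, HasDerivAt Y (Y' x) x)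
    (h2 : ∀ x, HasDerivAt Y' (2 - 4 * l * Y x) x) (h : ℝ) (e k : ℕ) :
    ∃ H : ℝ → ℝ, (∀ τ, HasDerivAt (branchSum h e k Y) (H τ) τ) ∧
      ∀ τ, HasDerivAt H (2 * (2 * k + 1) - 4 * l * branchSum h e k Y τ) τ := by
  refine ⟨fun τ => ∑ i ∈ Finset.range (2 * k + 1), Y' (branch h e i τ) * (-1) ^ i,
    fun τ => ?_, fun τ => ?_⟩
  · exact HasDerivAt.fun_sum fun i _ => (h1 _).comp τ (hasDerivAt_branch h e i τ)
  · have := HasDerivAt.fun_sum (u := Finset.range (2 * k + 1))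
      (A := fun i τ => Y' (branch h e i τ) * (-1) ^ i) (x := τ) (fun i _ =>
      ((h2 _).comp τ (hasDerivAt_branch h e i τ)).mul_const ((-1 : ℝ) ^ i))
    refine this.congr_deriv ?_
    have hs : ∀ i ∈ Finset.range (2 * k + 1),
        (2 - 4 * l * Y (branch h e i τ)) * (-1) ^ i * (-1) ^ i
          = 2 - 4 * l * Y (branch h e i τ) := by
      intro i _
      rw [mul_assoc, ← mul_pow]
      simp
    rw [Finset.sum_congr rfl hs, Finset.sum_sub_distrib, ← Finset.mul_sum]
    simp [branchSum]
    ring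

/-- A branch sum of a nonconstant square of a sine is not locally constant. -/
theorem exists_deriv_branchSum_ne_zero {Y H : ℝ → ℝ} {l h a c : ℝ} {e k : ℕ} (he : e < 2)
    (hac : a < c)
    (hH' : ∀ τ, HasDerivAt H (2 * (2 * k + 1) - 4 * l * branchSum h e k Y τ) τ)
    (hexp : l ≠ 0 → ∃ r : ℂ, r ^ 2 = -4 * l ∧ ∀ x : ℝ,
      r ^ 2 * (Y x : ℂ) = Complex.exp (r * x) + Complex.exp (-(r * x)) - 2) :
    ∃ τ ∈ Ioo a c, H τ ≠ 0 := by
  by_contra! hcon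
  have hG : ∀ τ ∈ Ioo a c, 2 * (2 * k + 1) - 4 * l * branchSum h e k Y τ = 0 := by
    intro τ hτ
    refine (hH' τ).unique ((hasDerivAt_const τ (0 : ℝ)).congr_of_eventuallyEq ?_)
    filter_upwards [Ioo_mem_nhds hτ.1 hτ.2] with t ht
    exact hcon t ht
  have hmid : (a + c) / 2 ∈ Ioo a c := ⟨by linarith, by linarith⟩
  have hl : l ≠ 0 := by
    rintro rfl
    have := hG _ hmid
    have hk : (0 : ℝ) ≤ k := Nat.cast_nonneg k
    linarith
  obtain ⟨r, hr, hY⟩ := hexp hl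
  have hr0 : r ≠ 0 := by
    rintro rfl
    apply hl
    have : (l : ℂ) = 0 := by
      linear_combination (1 / 4 : ℂ) * hr
    exact_mod_cast this
  set x := Complex.exp (r * h) with hx
  set y := Complex.exp (-(r * h)) with hy
  have hxy : x * y = 1 := by rw [hx, hy, ← Complex.exp_add]; simp
  set P := ∑ i ∈ Finset.range (2 * k + 1), (if Even i then x else y) ^ (i + e) with hP
  set P' := ∑ i ∈ Finset.range (2 * k + 1), (if Even i then y else x) ^ (i + e) with hP'
  -- The sign of `τ` alternates with `i`, so on odd branches the roles of the two exponentials are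
  -- exchanged. This is why `x` and `y` alternate.
  have hsum : ∀ τ : ℝ, r ^ 2 * (branchSum h e k Y τ : ℂ)
      = P * Complex.exp (r * τ) + P' * Complex.exp (-(r * τ)) - 2 * (2 * k + 1) := by
    intro τ
    rw [branchSum, Complex.ofReal_sum, Finset.mul_sum, hP, hP', Finset.sum_mul, Finset.sum_mul,
      ← Finset.sum_add_distrib]
    have hconst : (2 * (2 * k + 1) : ℂ) = ∑ i ∈ Finset.range (2 * k + 1), (2 : ℂ) := by
      simp; ring
    rw [hconst, ← Finset.sum_sub_distrib]
    refine Finset.sum_congr rfl fun i _ => ?_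
    rw [hY]
    congr 1
    rcases Nat.even_or_odd i with hi | hi
    · rw [if_pos hi, if_pos hi, hx, hy, ← Complex.exp_nat_mul, ← Complex.exp_nat_mul,
        ← Complex.exp_add, ← Complex.exp_add, branch, hi.neg_one_pow]
      push_cast
      ring_nf
    · rw [if_neg (Nat.not_even_iff_odd.2 hi), if_neg (Nat.not_even_iff_odd.2 hi), hx, hy,
        ← Complex.exp_nat_mul, ← Complex.exp_nat_mul,
        ← Complex.exp_add, ← Complex.exp_add, branch, hi.neg_one_pow, add_comm]
      push_cast
      ring_nf
  have hzero : ∀ τ ∈ Ioo a c, P * Complex.exp (r * τ) + P' * Complex.exp (-(r * τ)) = 0 := by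
    intro τ hτ
    have h1 := hsum τ
    have h2 : (2 * (2 * k + 1) - 4 * l * branchSum h e k Y τ : ℂ) = 0 := by
      exact_mod_cast hG τ hτ
    rw [hr] at h1
    linear_combination -h1 + h2
  have hzero' : P * (Complex.exp (r * ((a + c) / 2 : ℝ)) * r)
      + P' * (Complex.exp (-(r * ((a + c) / 2 : ℝ))) * -r) = 0 := by
    have hlin : HasDerivAt (fun τ : ℝ => r * (τ : ℂ)) r ((a + c) / 2) := by
      simpa using (Complex.ofRealCLM.hasDerivAt (x := (a + c) / 2)).const_mul r
    have hder := (hlin.cexp.const_mul P).add (hlin.neg.cexp.const_mul P')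
    refine hder.unique ((hasDerivAt_const _ (0 : ℂ)).congr_of_eventuallyEq ?_)
    filter_upwards [Ioo_mem_nhds hmid.1 hmid.2] with t ht
    exact hzero t ht
  have hz := hzero _ hmid
  have e1 : P = 0 := by
    have : 2 * r * Complex.exp (r * ((a + c) / 2 : ℝ)) * P = 0 := by
      linear_combination hzero' + r * hz
    rcases mul_eq_zero.1 this with h | h
    · exact absurd h (mul_ne_zero (mul_ne_zero two_ne_zero hr0) (Complex.exp_ne_zero _))
    · exact h
  have e2 : P' = 0 := by
    rw [e1, zero_mul, zero_add] at hz
    exact (mul_eq_zero.1 hz).resolve_right (Complex.exp_ne_zero _)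
  exact sum_alternating_pow_ne_zero hxy he k e1 e2

/-- Solutions of `f'' = r f` for different `r` are linearly independent on every interval. -/
theorem eq_zero_of_sum_eigenfunctions {n : ℕ} {f f' : Fin n → ℝ → ℝ} {r : Fin n → ℝ}
    (hr : Function.Injective r) (h1 : ∀ i x, HasDerivAt (f i) (f' i x) x)
    (h2 : ∀ i x, HasDerivAt (f' i) (r i * f i x) x) {a c : ℝ}
    (hsum : ∀ x ∈ Ioo a c, ∑ i, f i x = 0) (i : Fin n) : ∀ x ∈ Ioo a c, f i x = 0 := by
  -- Two differentiations multiply the `i`-th term by `r i`. The resulting relations for all `j`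
  -- form a Vandermonde system.
  have key : ∀ j : ℕ, ∀ x ∈ Ioo a c, ∑ i, f i x * r i ^ j = 0 := by
    intro j
    induction j with
    | zero => simpa using hsum
    | succ j ih =>
      have d1 : ∀ x ∈ Ioo a c, ∑ i, f' i x * r i ^ j = 0 := by
        intro x hx
        refine (HasDerivAt.fun_sum (u := Finset.univ) (A := fun i x => f i x * r i ^ j)
          fun i _ => (h1 i x).mul_const (r i ^ j)).unique
          ((hasDerivAt_const x (0 : ℝ)).congr_of_eventuallyEq ?_)
        filter_upwards [Ioo_mem_nhds hx.1 hx.2] with t ht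
        exact ih t ht
      intro x hx
      have := (HasDerivAt.fun_sum (u := Finset.univ) (A := fun i x => f' i x * r i ^ j)
          fun i _ => (h2 i x).mul_const (r i ^ j)).unique
          ((hasDerivAt_const x (0 : ℝ)).congr_of_eventuallyEq (by
            filter_upwards [Ioo_mem_nhds hx.1 hx.2] with t ht
            exact d1 t ht))
      rw [← this]
      refine Finset.sum_congr rfl fun i _ => ?_
      ring
  intro x hx
  have := Matrix.eq_zero_of_forall_pow_sum_mul_pow_eq_zero (v := fun i => f i x) hr
    (fun j => key j x hx)
  exact congrFun this i

/-- The functions `G_l` with `G_l'' = 2 M - 4 λ_l G_l` are linearly independent modulo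
`cos² (s τ)` and `cos (s τ)`. -/
theorem eq_zero_of_sum_branchSum_eq {N : ℕ} {G H : Fin N → ℝ → ℝ} {lam α : Fin N → ℝ}
    {s M τ₁ A B : ℝ} (hs : 0 < s) (hM : 0 < M) (hτ₁ : 0 < τ₁) (hτs : s * τ₁ < Real.pi / 2)
    (hinj : Function.Injective lam) (hlam : ∀ l, lam l < s ^ 2)
    (h1 : ∀ l x, HasDerivAt (G l) (H l x) x)
    (h2 : ∀ l x, HasDerivAt (H l) (2 * M - 4 * lam l * G l x) x)
    (hne : ∀ l, ∃ x ∈ Ioo 0 τ₁, H l x ≠ 0)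
    (heq : ∀ x ∈ Ioo 0 τ₁, ∑ l, α l * G l x
      = A * Real.cos (s * x) ^ 2 + B * Real.cos (s * x)) : α = 0 := by
  have hsx : ∀ x : ℝ, HasDerivAt (fun x : ℝ => s * x) s x := fun x => by
    simpa using (hasDerivAt_id x).const_mul s
  have hcos : ∀ x : ℝ, HasDerivAt (fun x : ℝ => Real.cos (s * x)) (-Real.sin (s * x) * s) x :=
    fun x => (hsx x).cos
  have hsin : ∀ x : ℝ, HasDerivAt (fun x : ℝ => Real.sin (s * x)) (Real.cos (s * x) * s) x :=
    fun x => (hsx x).sin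
  have hdiff : ∀ {u v u' v' : ℝ → ℝ}, (∀ x ∈ Ioo 0 τ₁, u x = v x) →
      (∀ x, HasDerivAt u (u' x) x) → (∀ x, HasDerivAt v (v' x) x) →
      ∀ x ∈ Ioo 0 τ₁, u' x = v' x := by
    intro u v u' v' huv hu hv x hx
    refine (hu x).unique ((hv x).congr_of_eventuallyEq ?_)
    filter_upwards [Ioo_mem_nhds hx.1 hx.2] with t ht
    exact huv t ht
  have q1 := hdiff heq
    (fun x => HasDerivAt.fun_sum fun l _ => (h1 l x).const_mul (α l))
    (fun x => (((hcos x).pow 2).const_mul A).add ((hcos x).const_mul B))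
  have q1' : ∀ x ∈ Ioo 0 τ₁, ∑ l, α l * H l x
      = -2 * A * s * (Real.cos (s * x) * Real.sin (s * x)) - B * s * Real.sin (s * x) := by
    intro x hx
    rw [q1 x hx]
    push_cast
    ring
  have q2 := hdiff q1'
    (fun x => HasDerivAt.fun_sum fun l _ => (h2 l x).const_mul (α l))
    (fun x => (((hcos x).mul (hsin x)).const_mul (-2 * A * s)).sub ((hsin x).const_mul (B * s)))
  have hlin : ∀ x, ∑ l, α l * (2 * M - 4 * lam l * G l x)
      = 2 * M * ∑ l, α l - ∑ l, α l * (4 * lam l) * G l x := by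
    intro x
    rw [Finset.mul_sum, ← Finset.sum_sub_distrib]
    exact Finset.sum_congr rfl fun l _ => by ring
  have q2' : ∀ x ∈ Ioo 0 τ₁, ∑ l, α l * (4 * lam l) * G l x
      = 2 * M * ∑ l, α l + 2 * A * s ^ 2 * (Real.cos (s * x) ^ 2 - Real.sin (s * x) ^ 2)
        + B * s ^ 2 * Real.cos (s * x) := by
    intro x hx
    have := q2 x hx
    rw [hlin] at this
    linear_combination -this
  have q3 := hdiff q2'
    (fun x => HasDerivAt.fun_sum fun l _ => (h1 l x).const_mul (α l * (4 * lam l)))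
    (fun x => (((((hcos x).pow 2).sub ((hsin x).pow 2)).const_mul (2 * A * s ^ 2)).const_add
      (2 * M * ∑ l, α l)).add ((hcos x).const_mul (B * s ^ 2)))
  -- This combines the first and third derivatives as `s²` plus the second derivative. It
  -- annihilates `sin (s x)` and multiplies `sin cos` by `s² - 4 s²`.
  have q4 : ∀ x ∈ Ioo 0 τ₁, ∑ l, α l * (s ^ 2 - 4 * lam l) * H l x
      = 6 * A * s ^ 3 * (Real.sin (s * x) * Real.cos (s * x)) := by
    intro x hx
    have e1 : ∑ l, α l * (s ^ 2 - 4 * lam l) * H l x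
        = s ^ 2 * ∑ l, α l * H l x - ∑ l, α l * (4 * lam l) * H l x := by
      rw [Finset.mul_sum, ← Finset.sum_sub_distrib]
      exact Finset.sum_congr rfl fun l _ => by ring
    rw [e1, q1' x hx, q3 x hx]
    push_cast
    ring
  let f : Fin (N + 1) → ℝ → ℝ := Fin.cons
    (fun x => -(6 * A * s ^ 3) * (Real.sin (s * x) * Real.cos (s * x)))
    (fun l x => α l * (s ^ 2 - 4 * lam l) * H l x)
  let f' : Fin (N + 1) → ℝ → ℝ := Fin.cons
    (fun x => -(6 * A * s ^ 3) * (Real.cos (s * x) * s * Real.cos (s * x)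
      + Real.sin (s * x) * (-Real.sin (s * x) * s)))
    (fun l x => α l * (s ^ 2 - 4 * lam l) * (2 * M - 4 * lam l * G l x))
  -- The product `sin cos` is an eigenfunction for `-4 s²`, distinct from all `-4 lam l` since `lam
  -- l < s²`.
  let r : Fin (N + 1) → ℝ := Fin.cons (-4 * s ^ 2) (fun l => -4 * lam l)
  have hr : Function.Injective r := by
    refine Fin.cons_injective_iff.2 ⟨?_, fun i j hij => hinj ?_⟩
    · rintro ⟨l, hl⟩
      have := hlam l
      simp only at hl
      linarith
    · simp only at hij
      linarith
  have hall := eq_zero_of_sum_eigenfunctions (f := f) (f' := f') hr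
    (fun i x => by
      refine Fin.cases ?_ (fun l => ?_) i
      · exact ((hsin x).mul (hcos x)).const_mul _
      · exact (h2 l x).const_mul _)
    (fun i x => by
      refine Fin.cases ?_ (fun l => ?_) i
      · refine (((((hcos x).mul_const s).mul (hcos x)).add
          ((hsin x).mul ((hsin x).neg.mul_const s))).const_mul
          (-(6 * A * s ^ 3))).congr_deriv ?_
        simp only [r, f, Fin.cons_zero, Pi.neg_apply]
        ring
      · refine (((h1 l x).const_mul (4 * lam l)).const_sub (2 * M) |>.const_mul
          (α l * (s ^ 2 - 4 * lam l))).congr_deriv ?_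
        simp only [r, f, Fin.cons_succ]
        ring)
    (a := 0) (c := τ₁) (fun x hx => by
      rw [Fin.sum_univ_succ]
      simp only [f, Fin.cons_zero, Fin.cons_succ]
      rw [q4 x hx]
      ring)
  have hα : ∀ l, α l * (s ^ 2 - 4 * lam l) = 0 := by
    intro l
    obtain ⟨x, hx, hxne⟩ := hne l
    have := hall l.succ x hx
    simp only [f, Fin.cons_succ] at this
    exact (mul_eq_zero.1 this).resolve_right hxne
  have hmid : τ₁ / 2 ∈ Ioo 0 τ₁ := ⟨by linarith, by linarith⟩
  have hA : A = 0 := by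
    have h0 := hall 0 _ hmid
    simp only [f, Fin.cons_zero] at h0
    have hp1 : 0 < Real.sin (s * (τ₁ / 2)) := by
      apply Real.sin_pos_of_pos_of_lt_pi
      · positivity
      · nlinarith [Real.pi_pos]
    have hp2 : 0 < Real.cos (s * (τ₁ / 2)) := by
      apply Real.cos_pos_of_mem_Ioo
      constructor
      · have : 0 < s * (τ₁ / 2) := by positivity
        linarith [Real.pi_pos]
      · nlinarith
    have h3 := (mul_eq_zero.1 h0).resolve_right (mul_pos hp1 hp2).ne'
    have h4 : A * (6 * s ^ 3) = 0 := by linarith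
    exact (mul_eq_zero.1 h4).resolve_right (by positivity)
  -- Wherever `α l ≠ 0` one has `4 lam l = s²`, so with `A = 0` the cosine terms of the
  -- second-derivative identity cancel and only its constant is left.
  have hsumα : ∑ l, α l = 0 := by
    have e1 := q2' _ hmid
    have e2 := heq _ hmid
    have e3 : ∑ l, α l * (4 * lam l) * G l (τ₁ / 2) = s ^ 2 * ∑ l, α l * G l (τ₁ / 2) := by
      rw [Finset.mul_sum]
      refine Finset.sum_congr rfl fun l _ => ?_
      linear_combination -G l (τ₁ / 2) * hα l
    rw [e3, e2, hA] at e1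
    have : 2 * M * ∑ l, α l = 0 := by linear_combination -e1
    exact (mul_eq_zero.1 this).resolve_left (by positivity)
  funext l
  by_contra hl
  have hl4 : s ^ 2 - 4 * lam l = 0 := (mul_eq_zero.1 (hα l)).resolve_left hl
  rw [Finset.sum_eq_single l] at hsumα
  · exact hl hsumα
  · intro j _ hj
    refine (mul_eq_zero.1 (hα j)).resolve_right fun h => hj (hinj ?_)
    linarith
  · simp

end BranchSums

/-! ### Folding the integrals, pulling back test functions, explicit linear solutions. -/

section Independence

theorem intervalIntegral_eq_zero_of_eqOn {F : ℝ → ℝ} {a c : ℝ} (hac : a ≤ c)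
    (h : ∀ z ∈ Icc a c, F z = 0) : ∫ z in a..c, F z = 0 := by
  rw [intervalIntegral.integral_congr (g := fun _ => 0)
    (fun z hz => h z (by rwa [uIcc_of_le hac] at hz))]
  simp

/-- The integral over `[0, (2 k + e) h + ρ]` of a function supported on the branches. -/
theorem integral_eq_integral_branchSum {F : ℝ → ℝ} (hF : Continuous F) {h τ₁ ρ : ℝ} {e : ℕ}
    (hτ₁ : 0 < τ₁) (h1 : τ₁ ≤ ρ) (h2 : ρ ≤ h - τ₁)
    (V0 : ∀ z ∈ Icc 0 (e * h), F z = 0)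
    (V1 : ∀ j : ℕ, ∀ τ ∈ Icc τ₁ (h - τ₁), F ((2 * j + e) * h + τ) = 0)
    (V2 : ∀ j : ℕ, ∀ τ ∈ Icc h (2 * h), F ((2 * j + e) * h + τ) = 0) (k : ℕ) :
    ∫ z in (0 : ℝ)..(2 * k + e) * h + ρ, F z = ∫ τ in (0 : ℝ)..τ₁, branchSum h e k F τ := by
  have hi : ∀ a c : ℝ, IntervalIntegrable F MeasureTheory.volume a c := fun a c =>
    hF.intervalIntegrable a c
  have hh : 0 < h := by linarith
  have hplus : ∀ c : ℝ, ∫ z in c..c + τ₁, F z = ∫ τ in (0 : ℝ)..τ₁, F (c + τ) := by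
    intro c
    rw [intervalIntegral.integral_comp_add_left (fun x => F x) c, add_zero]
  have hminus : ∀ c : ℝ, ∫ z in c - τ₁..c, F z = ∫ τ in (0 : ℝ)..τ₁, F (c - τ) := by
    intro c
    rw [intervalIntegral.integral_comp_sub_left (fun x => F x) c, sub_zero]
  have hshift : ∀ {c a a' : ℝ}, a ≤ a' → (∀ τ ∈ Icc a a', F (c + τ) = 0) →
      ∫ z in c + a..c + a', F z = 0 := by
    intro c a a' haa h0
    refine intervalIntegral_eq_zero_of_eqOn (by linarith) fun z hz => ?_
    have := h0 (z - c) ⟨by linarith [hz.1], by linarith [hz.2]⟩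
    rwa [add_sub_cancel] at this
  induction k with
  | zero =>
    have e0 : ∫ z in (0 : ℝ)..e * h, F z = 0 :=
      intervalIntegral_eq_zero_of_eqOn (by positivity) V0
    have e1 := hplus (e * h)
    have e2 : ∫ z in e * h + τ₁..e * h + ρ, F z = 0 := by
      refine hshift h1 fun τ hτ => ?_
      have := V1 0 τ ⟨hτ.1, hτ.2.trans h2⟩
      simpa using this
    have hsum : ∀ τ, branchSum h e 0 F τ = F (e * h + τ) := by
      intro τ; simp [branchSum, branch]
    simp only [hsum, Nat.cast_zero, mul_zero, zero_add]
    rw [← intervalIntegral.integral_add_adjacent_intervals (hi _ (e * h)) (hi _ _), e0, zero_add,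
      ← intervalIntegral.integral_add_adjacent_intervals (hi _ (e * h + τ₁)) (hi _ _), e1, e2,
      add_zero]
  | succ k ih =>
    -- Raising `k` by one lengthens the interval by the period `2 h`. It contributes two pieces of
    -- length `τ₁`: a reflected one ending at `c + h` and a direct one starting at `c + 2 h`.
    set c : ℝ := (2 * k + e) * h with hc
    have hc2 : (2 * ((k + 1 : ℕ) : ℝ) + e) * h = c + 2 * h := by
      rw [hc]; push_cast; ring
    have e1 : ∫ z in c + ρ..c + (h - τ₁), F z = 0 :=
      hshift h2 fun τ hτ => V1 k τ ⟨h1.trans hτ.1, hτ.2⟩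
    have e2 := hminus (c + h)
    have e3 : ∫ z in c + h..c + 2 * h, F z = 0 :=
      hshift (by linarith) fun τ hτ => V2 k τ hτ
    have e4 := hplus (c + 2 * h)
    have e5 : ∫ z in c + 2 * h + τ₁..c + 2 * h + ρ, F z = 0 := by
      refine hshift h1 fun τ hτ => ?_
      rw [← hc2]
      exact V1 (k + 1) τ ⟨hτ.1, hτ.2.trans h2⟩
    have hsum : ∀ τ, branchSum h e (k + 1) F τ
        = branchSum h e k F τ + F (c + h - τ) + F (c + 2 * h + τ) := by
      intro τ
      have o1 : ((-1 : ℝ)) ^ (2 * k + 1) = -1 := Odd.neg_one_pow (by simp)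
      have o2 : ((-1 : ℝ)) ^ (2 * k + 1 + 1) = 1 := by rw [pow_succ, o1]; norm_num
      rw [branchSum, show 2 * (k + 1) + 1 = 2 * k + 1 + 1 + 1 by ring, Finset.sum_range_succ,
        Finset.sum_range_succ, branchSum]
      congr 2
      · rw [branch, o1, hc]
        push_cast
        ring_nf
      · rw [branch, o2, hc]
        push_cast
        ring_nf
    have hb : Continuous (branchSum h e k F) := by
      unfold branchSum branch
      fun_prop
    rw [hc2]
    simp only [hsum]
    have c1 : Continuous fun τ => F (c + h - τ) := by fun_prop
    have c2 : Continuous fun τ => F (c + 2 * h + τ) := by fun_prop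
    have c3 : Continuous fun τ => branchSum h e k F τ + F (c + h - τ) := hb.add c1
    rw [intervalIntegral.integral_add (c3.intervalIntegrable _ _)
        (c2.intervalIntegrable _ _),
      intervalIntegral.integral_add (hb.intervalIntegrable _ _) (c1.intervalIntegrable _ _), ← ih, ← e2, ← e4,
      ← intervalIntegral.integral_add_adjacent_intervals (hi 0 (c + ρ)) (hi _ _),
      ← intervalIntegral.integral_add_adjacent_intervals (hi (c + ρ) (c + (h - τ₁))) (hi _ _), e1,
      ← intervalIntegral.integral_add_adjacent_intervals (hi (c + (h - τ₁)) (c + h)) (hi _ _),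
      ← intervalIntegral.integral_add_adjacent_intervals (hi (c + h) (c + 2 * h)) (hi _ _), e3,
      ← intervalIntegral.integral_add_adjacent_intervals (hi (c + 2 * h) (c + 2 * h + τ₁)) (hi _ _),
      e5, add_sub_assoc]
    ring

/-- Smooth functions on `(0, τ₁)` are pulled back from test functions by
`τ ↦ sin (s τ) / sin (s τ₁)`. -/
theorem exists_isTestFunction_comp_sin {s τ₁ : ℝ} (hs : 0 < s) (hτ₁ : 0 < τ₁)
    (hτs : s * τ₁ < Real.pi / 2) {g : ℝ → ℝ} (hg : ContDiff ℝ ∞ g)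
    (hgs : tsupport g ⊆ Ioo 0 τ₁) :
    ∃ w, IsTestFunction w ∧ ∀ τ ∈ Icc 0 τ₁, w (Real.sin (s * τ) / Real.sin (s * τ₁)) = g τ ∧
      deriv w (Real.sin (s * τ) / Real.sin (s * τ₁)) * (Real.cos (s * τ) * s / Real.sin (s * τ₁))
        = deriv g τ := by
  have hpi := Real.pi_pos
  have hsτ : 0 < s * τ₁ := by positivity
  set c := Real.sin (s * τ₁) with hc
  have hc0 : 0 < c := Real.sin_pos_of_pos_of_lt_pi hsτ (by linarith)
  have hc1 : c ≤ 1 := Real.sin_le_one _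
  set w : ℝ → ℝ := fun p => g (Real.arcsin (p * c) / s) with hw
  have hcont : Continuous fun p : ℝ => Real.arcsin (p * c) / s :=
    (Real.continuous_arcsin.comp (by fun_prop)).div_const s
  have hsub : tsupport w ⊆ Ioo 0 1 := by
    have h1 : tsupport w ⊆ (fun p : ℝ => Real.arcsin (p * c) / s) ⁻¹' tsupport g := by
      refine closure_minimal (fun p hp => ?_) ((isClosed_tsupport g).preimage hcont)
      exact subset_tsupport g hp
    intro p hp
    obtain ⟨h2, h3⟩ := hgs (h1 hp)
    rw [lt_div_iff₀ hs, zero_mul, Real.arcsin_pos] at h2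
    rw [div_lt_iff₀ hs, mul_comm τ₁, Real.arcsin_lt_iff_lt_sin' ⟨by linarith, hτs.le⟩] at h3
    exact ⟨pos_of_mul_pos_left h2 hc0.le, by rwa [← hc, mul_lt_iff_lt_one_left hc0] at h3⟩
  have hsmooth : ContDiff ℝ ∞ w := by
    rw [contDiff_iff_contDiffAt]
    intro p
    -- `arcsin` fails to be smooth only at ±1, and on the support `0 < p * c < 1`. Off the support
    -- `w` is locally zero.
    by_cases hp : p ∈ tsupport w
    · obtain ⟨p0, p1⟩ := hsub hp
      have hpc : p * c < 1 := by nlinarith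
      have hpc0 : 0 < p * c := mul_pos p0 hc0
      have ha : ContDiffAt ℝ ∞ Real.arcsin (p * c) :=
        Real.contDiffAt_arcsin (by linarith) hpc.ne
      have hlin : ContDiffAt ℝ ∞ (fun p : ℝ => p * c) p := contDiffAt_id.mul contDiffAt_const
      have hcomp : ContDiffAt ℝ ∞ (fun p : ℝ => Real.arcsin (p * c)) p :=
        ContDiffAt.comp (g := Real.arcsin) p ha hlin
      exact hg.contDiffAt.comp p (hcomp.div_const s)
    · rw [notMem_tsupport_iff_eventuallyEq] at hp
      exact contDiffAt_const.congr_of_eventuallyEq hp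
  refine ⟨w, ⟨hsmooth, ?_, hsub⟩, ?_⟩
  · exact IsCompact.of_isClosed_subset isCompact_Icc (isClosed_tsupport w)
      (hsub.trans Ioo_subset_Icc_self)
  · have hloc : ∀ τ : ℝ, -(Real.pi / 2) < s * τ → s * τ < Real.pi / 2 →
        w (Real.sin (s * τ) / c) = g τ := by
      intro τ h1 h2
      simp only [hw]
      rw [div_mul_cancel₀ _ hc0.ne', Real.arcsin_sin h1.le h2.le, mul_div_cancel_left₀ _ hs.ne']
    intro τ hτ
    have h1 : -(Real.pi / 2) < s * τ := by nlinarith [mul_nonneg hs.le hτ.1]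
    have h2 : s * τ < Real.pi / 2 := by nlinarith [mul_le_mul_of_nonneg_left hτ.2 hs.le]
    refine ⟨hloc τ h1 h2, ?_⟩
    have hsx : HasDerivAt (fun x : ℝ => s * x) s τ := by
      simpa using (hasDerivAt_id τ).const_mul s
    have hU : HasDerivAt (fun x : ℝ => Real.sin (s * x) / c) (Real.cos (s * τ) * s / c) τ :=
      hsx.sin.div_const c
    have hwd := ((hsmooth.differentiable (by simp)) (Real.sin (s * τ) / c)).hasDerivAt
    have hcomp := HasDerivAt.comp (h₂ := w) τ hwd hU
    refine hcomp.unique (((hg.differentiable (by simp)) τ).hasDerivAt.congr_of_eventuallyEq ?_)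
    have hcs : Continuous fun x : ℝ => s * x := by fun_prop
    filter_upwards [hcs.continuousAt.preimage_mem_nhds (Ioo_mem_nhds h1 h2)] with x hx
    exact hloc x hx.1 hx.2

theorem eq_zero_of_integral_mul_eq_zero {f : ℝ → ℝ} {τ₁ : ℝ}
    (hf : ContinuousOn f (Ioo 0 τ₁))
    (h : ∀ g : ℝ → ℝ, ContDiff ℝ ∞ g → tsupport g ⊆ Ioo 0 τ₁ →
      ∫ τ in (0 : ℝ)..τ₁, g τ * f τ = 0) : ∀ τ ∈ Ioo 0 τ₁, f τ = 0 := by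
  have hae := isOpen_Ioo.ae_eq_zero_of_integral_contDiff_smul_eq_zero
    (μ := MeasureTheory.volume) (hf.locallyIntegrableOn measurableSet_Ioo)
    (fun g hg _ hgs => by
      rw [← h g hg hgs, intervalIntegral.integral_eq_integral_of_support_subset]
      · rfl
      · intro x hx
        have : x ∈ Ioo 0 τ₁ := hgs (subset_tsupport g (fun h0 => hx (by simp [h0])))
        exact Ioo_subset_Ioc_self this)
  have := MeasureTheory.Measure.eqOn_open_of_ae_eq (f := f) (g := fun _ => 0)
    (μ := MeasureTheory.volume) ((MeasureTheory.ae_restrict_iff' measurableSet_Ioo).2 hae)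
    isOpen_Ioo hf continuousOn_const
  exact this

/-- A smooth function orthogonal (after pull-back) to all test functions has the form
`A cos² + B cos`. -/
theorem exists_cos_of_orthogonal {s τ₁ D : ℝ} (hs : 0 < s) (hτ₁ : 0 < τ₁)
    (hτs : s * τ₁ < Real.pi / 2) {A A' A'' : ℝ → ℝ} (hA : ∀ x, HasDerivAt A (A' x) x)
    (hA' : ∀ x, HasDerivAt A' (A'' x) x)
    (h : ∀ w, IsTestFunction w → ∫ τ in (0 : ℝ)..τ₁,
      (deriv w (Real.sin (s * τ) / Real.sin (s * τ₁)) * A τ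
        - D * (Real.sin (s * τ) / Real.sin (s * τ₁))
          * w (Real.sin (s * τ) / Real.sin (s * τ₁))) = 0) :
    ∃ a e : ℝ, ∀ x ∈ Ioo 0 τ₁, A x = a * Real.cos (s * x) ^ 2 + e * Real.cos (s * x) := by
  have hpi := Real.pi_pos
  have hsτ : 0 < s * τ₁ := by positivity
  set c := Real.sin (s * τ₁) with hc
  have hc0 : 0 < c := Real.sin_pos_of_pos_of_lt_pi hsτ (by linarith)
  have hcos : ∀ x ∈ Icc 0 τ₁, 0 < Real.cos (s * x) := by
    intro x hx
    apply Real.cos_pos_of_mem_Ioo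
    constructor
    · nlinarith [mul_nonneg hs.le hx.1]
    · nlinarith [mul_le_mul_of_nonneg_left hx.2 hs.le]
  have hsx : ∀ x : ℝ, HasDerivAt (fun x : ℝ => s * x) s x := fun x => by
    simpa using (hasDerivAt_id x).const_mul s
  have hAc : Continuous A := continuous_iff_continuousAt.2 fun x => (hA x).continuousAt
  have hAc' : Continuous A' := continuous_iff_continuousAt.2 fun x => (hA' x).continuousAt
  -- With U = sin(sτ)/c and g = w ∘ U one has w'(U) = g'/U', so B = A/U' is the coefficient of g'.
  -- Integration by parts then gives B' + D U = 0.
  set B : ℝ → ℝ := fun x => A x * c / (s * Real.cos (s * x)) with hB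
  set B' : ℝ → ℝ := fun x => (A' x * c * (s * Real.cos (s * x))
    - A x * c * (s * (-Real.sin (s * x) * s))) / (s * Real.cos (s * x)) ^ 2 with hB'
  have hBd : ∀ x ∈ Icc 0 τ₁, HasDerivAt B (B' x) x := fun x hx =>
    ((hA x).mul_const c).div ((hsx x).cos.const_mul s) (mul_pos hs (hcos x hx)).ne'
  have hBc' : ContinuousOn B' (Icc 0 τ₁) := by
    refine ContinuousOn.div (Continuous.continuousOn (by fun_prop))
      (Continuous.continuousOn (by fun_prop)) fun x hx => ?_
    exact pow_ne_zero 2 (mul_pos hs (hcos x hx)).ne'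
  have hzero : ∀ x ∈ Ioo 0 τ₁, B' x + D * (Real.sin (s * x) / c) = 0 := by
    refine eq_zero_of_integral_mul_eq_zero
      ((hBc'.mono Ioo_subset_Icc_self).add (Continuous.continuousOn (by fun_prop))) ?_
    intro g hg hgs
    obtain ⟨w, hw, hwg⟩ := exists_isTestFunction_comp_sin hs hτ₁ hτs hg hgs
    have hgc : Continuous g := hg.continuous
    have hgc' : Continuous (deriv g) := hg.continuous_deriv (by simp)
    have hg0 : g 0 = 0 := by
      by_contra hne
      exact (hgs (subset_tsupport g hne)).1.false
    have hg1 : g τ₁ = 0 := by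
      by_contra hne
      exact (hgs (subset_tsupport g hne)).2.false
    have hu : uIcc 0 τ₁ = Icc 0 τ₁ := uIcc_of_le hτ₁.le
    have hBi : IntervalIntegrable B' MeasureTheory.volume 0 τ₁ :=
      ContinuousOn.intervalIntegrable (by rwa [hu])
    have hBcont : ContinuousOn B (Icc 0 τ₁) := fun x hx => (hBd x hx).continuousAt.continuousWithinAt
    have hparts := intervalIntegral.integral_mul_deriv_eq_deriv_mul (a := 0) (b := τ₁)
      (u := B) (u' := B') (v := g) (v' := deriv g)
      (fun x hx => hBd x (by rwa [hu] at hx))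
      (fun x _ => ((hg.differentiable (by simp)) x).hasDerivAt)
      hBi (hgc'.intervalIntegrable _ _)
    rw [hg0, hg1, mul_zero, mul_zero, sub_zero, zero_sub] at hparts
    have hw0 := h w hw
    have hcongr : ∫ τ in (0 : ℝ)..τ₁, (deriv w (Real.sin (s * τ) / c) * A τ
        - D * (Real.sin (s * τ) / c) * w (Real.sin (s * τ) / c))
        = ∫ τ in (0 : ℝ)..τ₁, (B τ * deriv g τ - D * (Real.sin (s * τ) / c) * g τ) := by
      refine intervalIntegral.integral_congr fun τ hτ => ?_
      rw [hu] at hτ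
      obtain ⟨k1, k2⟩ := hwg τ hτ
      have hcp := hcos τ hτ
      simp only [← hc] at k1 k2
      simp only [k1, ← k2, hB]
      field_simp
    have hi1 : IntervalIntegrable (fun τ => B τ * deriv g τ) MeasureTheory.volume 0 τ₁ :=
      ContinuousOn.intervalIntegrable (by rw [hu]; exact hBcont.mul hgc'.continuousOn)
    have hi2 : IntervalIntegrable (fun τ => D * (Real.sin (s * τ) / c) * g τ)
        MeasureTheory.volume 0 τ₁ := Continuous.intervalIntegrable (by fun_prop) _ _
    have hi3 : IntervalIntegrable (fun τ => B' τ * g τ) MeasureTheory.volume 0 τ₁ :=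
      ContinuousOn.intervalIntegrable (by rw [hu]; exact hBc'.mul hgc.continuousOn)
    rw [hcongr, intervalIntegral.integral_sub hi1 hi2, hparts] at hw0
    have hfin : ∫ τ in (0 : ℝ)..τ₁, g τ * (B' τ + D * (Real.sin (s * τ) / c))
        = (∫ τ in (0 : ℝ)..τ₁, B' τ * g τ)
          + ∫ τ in (0 : ℝ)..τ₁, D * (Real.sin (s * τ) / c) * g τ := by
      rw [← intervalIntegral.integral_add hi3 hi2]
      exact intervalIntegral.integral_congr fun τ _ => by ring
    rw [hfin]
    linarith
  -- Integrating B' = -D U shows that B is a constant plus a multiple of the cosine. Multiplication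
  -- by U' yields the claim.
  have hK : ∀ x ∈ Ioo 0 τ₁, HasDerivAt (fun x => B x - D / (s * c) * Real.cos (s * x)) 0 x := by
    intro x hx
    refine ((hBd x (Ioo_subset_Icc_self hx)).sub ((hsx x).cos.const_mul _)).congr_deriv ?_
    rw [← hzero x hx]
    field_simp
    ring
  obtain ⟨E, hE⟩ := isOpen_Ioo.exists_is_const_of_deriv_eq_zero
    isPreconnected_Ioo (fun x hx => (hK x hx).differentiableAt.differentiableWithinAt)
    (fun x hx => (hK x hx).deriv)
  refine ⟨D / c ^ 2, E * s / c, fun x hx => ?_⟩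
  have h1 := hE x hx
  have hcp := hcos x (Ioo_subset_Icc_self hx)
  have h2 : A x = B x * (s * Real.cos (s * x)) / c := by
    simp only [hB]
    field_simp
  have h3 : B x = E + D / (s * c) * Real.cos (s * x) := by linarith
  rw [h2, h3]
  field_simp
  ring

/-- The solution of `φ'' + l φ = 0`, `φ(0) = 0`, `φ'(0) = 1` on the whole line. -/
theorem exists_linear_solution (l : ℝ) : ∃ φ ψ : ℝ → ℝ,
    (∀ x, HasDerivAt φ (ψ x) x) ∧ (∀ x, HasDerivAt ψ (-(l * φ x)) x) ∧ φ 0 = 0 ∧ ψ 0 = 1 ∧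
    (∀ x, ψ x ^ 2 + l * φ x ^ 2 = 1) ∧
    (l ≠ 0 → ∃ r : ℂ, r ^ 2 = -4 * l ∧ ∀ x : ℝ,
      r ^ 2 * ((φ x ^ 2 : ℝ) : ℂ) = Complex.exp (r * x) + Complex.exp (-(r * x)) - 2) := by
  rcases lt_trichotomy l 0 with hl | hl | hl
  · set t := Real.sqrt (-l) with ht
    have ht0 : 0 < t := Real.sqrt_pos.2 (by linarith)
    have ht2 : t ^ 2 = -l := Real.sq_sqrt (by linarith)
    have htx : ∀ x : ℝ, HasDerivAt (fun x : ℝ => t * x) t x := fun x => by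
      simpa using (hasDerivAt_id x).const_mul t
    refine ⟨fun x => Real.sinh (t * x) / t, fun x => Real.cosh (t * x), fun x => ?_, fun x => ?_,
      by simp, by simp, fun x => ?_, fun _ => ⟨2 * t, ?_, fun x => ?_⟩⟩
    · exact ((htx x).sinh.div_const t).congr_deriv (by field_simp)
    · refine (htx x).cosh.congr_deriv ?_
      have : l = -t ^ 2 := by linarith
      rw [this]
      field_simp
    · have : l = -t ^ 2 := by linarith
      rw [this, Real.cosh_sq]
      field_simp
      ring
    · have : ((t ^ 2 : ℝ) : ℂ) = ((-l : ℝ) : ℂ) := by rw [ht2]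
      push_cast at this
      linear_combination 4 * this
    · have h1 : ((2 * t : ℂ)) ^ 2 * (((Real.sinh (t * x) / t) ^ 2 : ℝ) : ℂ)
          = 4 * Complex.sinh (t * x) ^ 2 := by
        have : (t : ℂ) ≠ 0 := by exact_mod_cast ht0.ne'
        push_cast
        field_simp
        ring
      have h2 : Complex.exp (2 * t * x) = Complex.exp (t * x) ^ 2 := by
        rw [← Complex.exp_nat_mul]; push_cast; ring_nf
      have h3 : Complex.exp (-(2 * t * x)) = Complex.exp (-(t * x)) ^ 2 := by
        rw [← Complex.exp_nat_mul]; push_cast; ring_nf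
      have h4 : Complex.exp (t * x) * Complex.exp (-(t * x)) = 1 := by
        rw [← Complex.exp_add]; simp
      rw [h1, h2, h3, Complex.sinh]
      linear_combination -2 * h4
  · subst hl
    exact ⟨fun x => x, fun _ => 1, fun x => hasDerivAt_id x,
      fun x => by simpa using hasDerivAt_const x (1 : ℝ), rfl, rfl, by simp, fun h => absurd rfl h⟩
  · set t := Real.sqrt l with ht
    have ht0 : 0 < t := Real.sqrt_pos.2 hl
    have ht2 : t ^ 2 = l := Real.sq_sqrt hl.le
    have htx : ∀ x : ℝ, HasDerivAt (fun x : ℝ => t * x) t x := fun x => by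
      simpa using (hasDerivAt_id x).const_mul t
    refine ⟨fun x => Real.sin (t * x) / t, fun x => Real.cos (t * x), fun x => ?_, fun x => ?_,
      by simp, by simp, fun x => ?_, fun _ => ⟨2 * t * Complex.I, ?_, fun x => ?_⟩⟩
    · exact ((htx x).sin.div_const t).congr_deriv (by field_simp)
    · refine (htx x).cos.congr_deriv ?_
      rw [← ht2]
      field_simp
    · rw [← ht2, ← Real.sin_sq_add_cos_sq (t * x)]
      field_simp
      ring
    · have : ((t ^ 2 : ℝ) : ℂ) = (l : ℂ) := by rw [ht2]
      push_cast at this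
      linear_combination -4 * this + 4 * t ^ 2 * Complex.I_sq
    · have h1 : ((2 * t * Complex.I : ℂ)) ^ 2 * (((Real.sin (t * x) / t) ^ 2 : ℝ) : ℂ)
          = -4 * Complex.sin (t * x) ^ 2 := by
        have : (t : ℂ) ≠ 0 := by exact_mod_cast ht0.ne'
        push_cast
        field_simp
        linear_combination 4 * Complex.sin (t * x) ^ 2 * Complex.I_sq
      have h2 : Complex.exp (2 * t * Complex.I * x) = Complex.exp (t * x * Complex.I) ^ 2 := by
        rw [← Complex.exp_nat_mul]; push_cast; ring_nf
      have h3 : Complex.exp (-(2 * t * Complex.I * x)) = Complex.exp (-(t * x) * Complex.I) ^ 2 := by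
        rw [← Complex.exp_nat_mul]; push_cast; ring_nf
      have h4 : Complex.exp (t * x * Complex.I) * Complex.exp (-(t * x) * Complex.I) = 1 := by
        rw [← Complex.exp_add]; simp
      rw [h1, h2, h3, Complex.sin]
      linear_combination -2 * h4 - (Complex.exp (-(t * x) * Complex.I)
        - Complex.exp (t * x * Complex.I)) ^ 2 * Complex.I_sq

end Independence

/-! ### Independence of the eigenvalue derivatives and dual test functions. -/

section Functionals

/-- The excluded depths are the multiples of a quarter period: the even ones would give `ρ = 0`, the
odd ones `2ρ = π/s`. The parity `e` of the number of half periods is the sign of `sin (s d)`. -/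
theorem exists_halfPeriod_decomposition {s d : ℝ} (hs : 0 < s) (hd : 0 < d)
    (hsd : ∀ j : ℕ, 1 ≤ j → s ≠ Real.pi * j / (2 * d)) :
    ∃ (k e : ℕ) (ρ : ℝ), e < 2 ∧ 0 < ρ ∧ ρ < Real.pi / s ∧ 2 * ρ ≠ Real.pi / s ∧
      d = (2 * k + e) * (Real.pi / s) + ρ := by
  have hpi := Real.pi_pos
  set h := Real.pi / s with hh
  have hh0 : 0 < h := by positivity
  set n := ⌊d / h⌋₊ with hn
  have h1 : (n : ℝ) * h ≤ d := by
    have := Nat.floor_le (div_pos hd hh0).le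
    rwa [le_div_iff₀ hh0] at this
  have h2 : d < (n + 1) * h := by
    have := Nat.lt_floor_add_one (d / h)
    rwa [div_lt_iff₀ hh0] at this
  have hne : ∀ j : ℕ, 2 * d ≠ j * h := by
    intro j hj
    rcases Nat.eq_zero_or_pos j with rfl | hj0
    · simp at hj
      exact hd.ne' hj
    · apply hsd j hj0
      rw [hj, hh]
      have : (0 : ℝ) < j := by exact_mod_cast hj0
      field_simp
  have hcast : (2 * ((n / 2 : ℕ) : ℝ) + ((n % 2 : ℕ) : ℝ)) = n := by
    exact_mod_cast Nat.div_add_mod n 2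
  refine ⟨n / 2, n % 2, d - n * h, Nat.mod_lt _ (by norm_num), ?_, by linarith, ?_, ?_⟩
  · rcases h1.lt_or_eq with h3 | h3
    · linarith
    · exfalso
      apply hne (2 * n)
      push_cast
      linarith
  · intro h3
    apply hne (2 * n + 1)
    push_cast
    linarith
  · rw [hcast]
    ring

theorem IsTestFunction.eq_zero {w : ℝ → ℝ} (hw : IsTestFunction w) {p : ℝ} (hp : p ≤ 0 ∨ 1 ≤ p) :
    w p = 0 ∧ deriv w p = 0 := by
  have hp' : p ∉ tsupport w := by
    intro h
    obtain ⟨h1, h2⟩ := hw.2.2 h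
    rcases hp with hp | hp <;> linarith
  exact ⟨image_eq_zero_of_notMem_tsupport hp',
    by_contra fun h => hp' (support_deriv_subset h)⟩

theorem sin_branch {s h : ℝ} (hsh : s * h = Real.pi) (e i : ℕ) (τ : ℝ) :
    Real.sin (s * branch h e i τ) = (-1) ^ e * Real.sin (s * τ) := by
  have h1 : s * branch h e i τ = (-1) ^ i * (s * τ) + ((i + e : ℕ) : ℝ) * Real.pi := by
    rw [branch, ← hsh]; push_cast; ring
  rw [h1, Real.sin_add_nat_mul_pi]
  rcases Nat.even_or_odd i with hi | hi
  · rw [pow_add, hi.neg_one_pow]; simp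
  · rw [pow_add, hi.neg_one_pow]; simp

/-- The derivatives of the eigenvalues are linearly independent functionals of the
perturbation. -/
theorem eigenvalue_functionals_independent {s d : ℝ} (hs : 0 < s) (hd : 0 < d)
    (hsd : ∀ j : ℕ, 1 ≤ j → s ≠ Real.pi * j / (2 * d)) {N : ℕ} {lam α C : Fin N → ℝ}
    (hinj : Function.Injective lam) (hlam : ∀ l, lam l < s ^ 2) {φ ψ : Fin N → ℝ → ℝ}
    (h1 : ∀ l x, HasDerivAt (φ l) (ψ l x) x)
    (h2 : ∀ l x, HasDerivAt (ψ l) (-(lam l * φ l x)) x)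
    (hen : ∀ l x, ψ l x ^ 2 + lam l * φ l x ^ 2 = 1)
    (hexp : ∀ l, lam l ≠ 0 → ∃ r : ℂ, r ^ 2 = -4 * lam l ∧ ∀ x : ℝ,
      r ^ 2 * ((φ l x ^ 2 : ℝ) : ℂ) = Complex.exp (r * x) + Complex.exp (-(r * x)) - 2)
    (h : ∀ w, IsTestFunction w → ∑ l, α l *
      ((∫ z in (0 : ℝ)..d, deriv w (Real.sin (s * z) / Real.sin (s * d)) * φ l z ^ 2)
        - C l * ∫ z in (0 : ℝ)..d, Real.sin (s * z) / Real.sin (s * d)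
          * w (Real.sin (s * z) / Real.sin (s * d))) = 0) : α = 0 := by
  have hpi := Real.pi_pos
  obtain ⟨k, e, ρ, he, hρ0, hρh, hρ2, hdec⟩ := exists_halfPeriod_decomposition hs hd hsd
  set hh := Real.pi / s with hhdef
  have hsh : s * hh = Real.pi := by rw [hhdef]; field_simp
  -- The reflection of `ρ` into the first quarter period keeps the value of the sine and makes `sin
  -- (s τ)` strictly monotone on `[0, τ₁]`.
  set τ₁ := min ρ (hh - ρ) with hτ₁def
  have hτ₁ : 0 < τ₁ := lt_min hρ0 (by linarith)
  have hτ₁ρ : τ₁ ≤ ρ := min_le_left _ _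
  have hτ₁h : ρ ≤ hh - τ₁ := by
    have : τ₁ ≤ hh - ρ := min_le_right _ _
    linarith
  have hτs : s * τ₁ < Real.pi / 2 := by
    have : 2 * τ₁ < hh := by
      rcases lt_or_gt_of_ne hρ2 with h3 | h3
      · linarith
      · have : τ₁ ≤ hh - ρ := min_le_right _ _
        linarith
    nlinarith
  have hsinρ : Real.sin (s * ρ) = Real.sin (s * τ₁) := by
    rcases min_choice ρ (hh - ρ) with h3 | h3
    · rw [hτ₁def, h3]
    · rw [hτ₁def, h3, mul_sub, hsh, Real.sin_pi_sub]
  set c := Real.sin (s * τ₁) with hc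
  have hc0 : 0 < c :=
    Real.sin_pos_of_pos_of_lt_pi (by positivity) (by linarith)
  have hε : ((-1 : ℝ) ^ e) * (-1) ^ e = 1 := by rw [← mul_pow]; simp
  have hε0 : ((-1 : ℝ) ^ e) ≠ 0 := pow_ne_zero _ (by norm_num)
  have hshift : ∀ (j : ℕ) (τ : ℝ), Real.sin (s * ((2 * j + e) * hh + τ))
      = (-1) ^ e * Real.sin (s * τ) := by
    intro j τ
    rw [← sin_branch hsh e (2 * j) τ, branch, Even.neg_one_pow (by simp)]
    push_cast
    ring_nf
  have hsind : Real.sin (s * d) = (-1) ^ e * c := by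
    rw [hdec, hshift, hsinρ]
  have hlevel : ∀ (j : ℕ) (τ : ℝ), Real.sin (s * ((2 * j + e) * hh + τ)) / Real.sin (s * d)
      = Real.sin (s * τ) / c := by
    intro j τ
    rw [hshift, hsind, mul_div_mul_left _ _ hε0]
  have hlevelb : ∀ (i : ℕ) (τ : ℝ), Real.sin (s * branch hh e i τ) / Real.sin (s * d)
      = Real.sin (s * τ) / c := by
    intro i τ
    rw [sin_branch hsh, hsind, mul_div_mul_left _ _ hε0]
  have hφc : ∀ l, Continuous (φ l) := fun l =>
    continuous_iff_continuousAt.2 fun x => (h1 l x).continuousAt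
  have hY1 : ∀ l x, HasDerivAt (fun x => φ l x ^ 2) (2 * φ l x * ψ l x) x := fun l x => by
    refine ((h1 l x).pow 2).congr_deriv ?_
    push_cast
    ring
  have hY2 : ∀ l x, HasDerivAt (fun x => 2 * φ l x * ψ l x) (2 - 4 * lam l * φ l x ^ 2) x := by
    intro l x
    refine (((h1 l x).const_mul 2).mul (h2 l x)).congr_deriv ?_
    linear_combination 2 * hen l x
  choose H hH hH' using fun l => exists_hasDerivAt_branchSum (hY1 l) (hY2 l) hh e k
  set G : Fin N → ℝ → ℝ := fun l => branchSum hh e k fun x => φ l x ^ 2 with hG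
  set D : ℝ := ∑ l, α l * C l with hD
  have horth : ∀ w, IsTestFunction w → ∫ τ in (0 : ℝ)..τ₁,
      (deriv w (Real.sin (s * τ) / c) * ∑ l, α l * G l τ
        - D * (2 * k + 1) * (Real.sin (s * τ) / c) * w (Real.sin (s * τ) / c)) = 0 := by
    intro w hw
    have hwc : Continuous w := hw.1.continuous
    have hwc' : Continuous (deriv w) := hw.1.continuous_deriv (by simp)
    set U : ℝ → ℝ := fun z => Real.sin (s * z) / Real.sin (s * d) with hU
    have hUc : Continuous U := by fun_prop
    set F : ℝ → ℝ := fun z => deriv w (U z) * (∑ l, α l * φ l z ^ 2) - D * (U z * w (U z)) with hF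
    have hFc : Continuous F := by fun_prop
    have hF0 : ∀ z, U z ≤ 0 ∨ 1 ≤ U z → F z = 0 := by
      intro z hz
      obtain ⟨k1, k2⟩ := hw.eq_zero hz
      simp only [hF, k1, k2]
      ring
    have hFint : ∫ z in (0 : ℝ)..d, F z = 0 := by
      refine Eq.trans ?_ (h w hw)
      have hi : ∀ l, IntervalIntegrable (fun z => α l * (deriv w (U z) * φ l z ^ 2))
          MeasureTheory.volume 0 d := fun l => by
        have := hφc l
        exact Continuous.intervalIntegrable (by fun_prop) _ _
      have hs1 : ∫ z in (0 : ℝ)..d, deriv w (U z) * (∑ l, α l * φ l z ^ 2)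
          = ∑ l, α l * ∫ z in (0 : ℝ)..d, deriv w (U z) * φ l z ^ 2 := by
        simp only [← intervalIntegral.integral_const_mul]
        rw [← intervalIntegral.integral_finsetSum fun l _ => hi l]
        refine intervalIntegral.integral_congr fun z _ => ?_
        simp only [Finset.mul_sum]
        exact Finset.sum_congr rfl fun l _ => by ring
      rw [intervalIntegral.integral_sub (Continuous.intervalIntegrable (by fun_prop) _ _)
        (Continuous.intervalIntegrable (by fun_prop) _ _), hs1,
        intervalIntegral.integral_const_mul, hD, Finset.sum_mul, ← Finset.sum_sub_distrib]
      exact Finset.sum_congr rfl fun l _ => by ring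
    -- The three side conditions hold because off the branches the stream solution is at most 0 or
    -- at least 1, where test functions and their derivatives vanish.
    have hfold := integral_eq_integral_branchSum hFc (h := hh) (e := e) hτ₁ hτ₁ρ hτ₁h ?_ ?_ ?_ k
    · rw [← hdec, hFint] at hfold
      refine Eq.trans ?_ hfold.symm
      refine intervalIntegral.integral_congr fun τ _ => ?_
      simp only [hF, branchSum, hU, hlevelb, Finset.sum_sub_distrib, ← Finset.mul_sum, hG,
        Finset.sum_const, Finset.card_range, nsmul_eq_mul]
      rw [Finset.sum_comm]
      simp only [← Finset.mul_sum]
      push_cast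
      ring
    · intro z hz
      refine hF0 z (Or.inl ?_)
      interval_cases e
      · have : z = 0 := by
          have h3 := hz.1
          have h4 := hz.2
          simp at h4
          linarith
        simp [hU, this]
      · simp only [hU, hsind]
        have h4 := hz.2
        simp only [Nat.cast_one, one_mul] at h4
        refine div_nonpos_of_nonneg_of_nonpos ?_ (by linarith)
        refine Real.sin_nonneg_of_nonneg_of_le_pi (mul_nonneg hs.le hz.1) ?_
        rw [← hsh]
        exact mul_le_mul_of_nonneg_left h4 hs.le
    · intro j τ hτ
      refine hF0 _ (Or.inr ?_)
      simp only [hU]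
      rw [hlevel, le_div_iff₀ hc0, one_mul]
      have hs1 : s * τ₁ ≤ s * τ := mul_le_mul_of_nonneg_left hτ.1 hs.le
      have hs2 : s * τ ≤ Real.pi - s * τ₁ := by
        rw [← hsh, ← mul_sub]
        exact mul_le_mul_of_nonneg_left hτ.2 hs.le
      have hs0 : 0 < s * τ₁ := by positivity
      rcases le_total (s * τ) (Real.pi / 2) with h3 | h3
      · exact Real.sin_le_sin_of_le_of_le_pi_div_two (by linarith) h3 hs1
      · rw [← Real.sin_pi_sub (s * τ)]
        exact Real.sin_le_sin_of_le_of_le_pi_div_two (by linarith) (by linarith) (by linarith)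
    · intro j τ hτ
      refine hF0 _ (Or.inl ?_)
      simp only [hU]
      rw [hlevel]
      refine div_nonpos_of_nonpos_of_nonneg ?_ hc0.le
      have hs1 : Real.pi ≤ s * τ := by
        rw [← hsh]
        exact mul_le_mul_of_nonneg_left hτ.1 hs.le
      have hs2 : s * τ ≤ 2 * Real.pi := by
        have := mul_le_mul_of_nonneg_left hτ.2 hs.le
        linarith
      have := Real.sin_nonneg_of_nonneg_of_le_pi (x := s * τ - Real.pi) (by linarith) (by linarith)
      rw [Real.sin_sub_pi] at this
      linarith
  obtain ⟨a, b, hab⟩ := exists_cos_of_orthogonal hs hτ₁ hτs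
    (A := fun τ => ∑ l, α l * G l τ) (D := D * (2 * k + 1))
    (fun x => HasDerivAt.fun_sum fun l _ => (hH l x).const_mul (α l))
    (fun x => HasDerivAt.fun_sum fun l _ => (hH' l x).const_mul (α l)) horth
  exact eq_zero_of_sum_branchSum_eq hs (M := 2 * k + 1) (by positivity) hτ₁ hτs hinj hlam hH hH'
    (fun l => exists_deriv_branchSum_ne_zero he hτ₁ (hH' l) (hexp l)) hab

theorem IsTestFunction.add {v w : ℝ → ℝ} (hv : IsTestFunction v) (hw : IsTestFunction w) :
    IsTestFunction (v + w) :=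
  ⟨hv.1.add hw.1, hv.2.1.add hw.2.1,
    (tsupport_add v w).trans (union_subset hv.2.2 hw.2.2)⟩

theorem IsTestFunction.smul {w : ℝ → ℝ} (c : ℝ) (hw : IsTestFunction w) :
    IsTestFunction (c • w) :=
  ⟨hw.1.const_smul c, hw.2.1.smul_left (f := fun _ => c),
    (closure_mono (Function.support_const_smul_subset c w)).trans hw.2.2⟩

/-- There are test functions dual to the derivatives of the eigenvalues. -/
theorem exists_dual_testFunctions {s d : ℝ} (hs : 0 < s) (hd : 0 < d)
    (hsd : ∀ j : ℕ, 1 ≤ j → s ≠ Real.pi * j / (2 * d)) {N : ℕ} {lam C : Fin N → ℝ}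
    (hinj : Function.Injective lam) (hlam : ∀ l, lam l < s ^ 2) {φ ψ : Fin N → ℝ → ℝ}
    (h1 : ∀ l x, HasDerivAt (φ l) (ψ l x) x)
    (h2 : ∀ l x, HasDerivAt (ψ l) (-(lam l * φ l x)) x)
    (hen : ∀ l x, ψ l x ^ 2 + lam l * φ l x ^ 2 = 1)
    (hexp : ∀ l, lam l ≠ 0 → ∃ r : ℂ, r ^ 2 = -4 * lam l ∧ ∀ x : ℝ,
      r ^ 2 * ((φ l x ^ 2 : ℝ) : ℂ) = Complex.exp (r * x) + Complex.exp (-(r * x)) - 2) :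
    ∃ w : Fin N → ℝ → ℝ, (∀ j, IsTestFunction (w j)) ∧ ∀ l j,
      (∫ z in (0 : ℝ)..d, deriv (w j) (Real.sin (s * z) / Real.sin (s * d)) * φ l z ^ 2)
        - C l * (∫ z in (0 : ℝ)..d, Real.sin (s * z) / Real.sin (s * d)
          * w j (Real.sin (s * z) / Real.sin (s * d))) = (Pi.single j 1 : Fin N → ℝ) l := by
  set U : ℝ → ℝ := fun z => Real.sin (s * z) / Real.sin (s * d) with hU
  have hUc : Continuous U := by fun_prop
  have hφc : ∀ l, Continuous (φ l) := fun l =>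
    continuous_iff_continuousAt.2 fun x => (h1 l x).continuousAt
  set L : (ℝ → ℝ) → Fin N → ℝ := fun w l =>
    (∫ z in (0 : ℝ)..d, deriv w (U z) * φ l z ^ 2) - C l * ∫ z in (0 : ℝ)..d, U z * w (U z)
    with hL
  have hi1 : ∀ w, IsTestFunction w → ∀ l, IntervalIntegrable
      (fun z => deriv w (U z) * φ l z ^ 2) MeasureTheory.volume 0 d := by
    intro w hw l
    have := hφc l
    have hwc' : Continuous (deriv w) := hw.1.continuous_deriv (by simp)
    exact Continuous.intervalIntegrable (by fun_prop) _ _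
  have hi2 : ∀ w, IsTestFunction w → IntervalIntegrable
      (fun z => U z * w (U z)) MeasureTheory.volume 0 d := by
    intro w hw
    have hwc : Continuous w := hw.1.continuous
    exact Continuous.intervalIntegrable (by fun_prop) _ _
  have hadd : ∀ v w, IsTestFunction v → IsTestFunction w → L (v + w) = L v + L w := by
    intro v w hv hw
    funext l
    have hdv : ∀ x, deriv (v + w) x = deriv v x + deriv w x := fun x =>
      deriv_add ((hv.1.differentiable (by simp)) x) ((hw.1.differentiable (by simp)) x)
    simp only [hL, hdv, Pi.add_apply, add_mul, mul_add]
    rw [intervalIntegral.integral_add (hi1 v hv l) (hi1 w hw l),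
      intervalIntegral.integral_add (hi2 v hv) (hi2 w hw)]
    ring
  have hsmul : ∀ (c : ℝ) w, IsTestFunction w → L (c • w) = c • L w := by
    intro c w hw
    funext l
    have hdw : ∀ x, deriv (c • w) x = c * deriv w x := fun x =>
      deriv_const_smul c ((hw.1.differentiable (by simp)) x)
    have e1 : ∀ z, c * deriv w (U z) * φ l z ^ 2 = c * (deriv w (U z) * φ l z ^ 2) :=
      fun z => by ring
    have e2 : ∀ z, U z * (c * w (U z)) = c * (U z * w (U z)) := fun z => by ring
    simp only [hL, hdw, Pi.smul_apply, smul_eq_mul, e1, e2, intervalIntegral.integral_const_mul]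
    ring
  let S : Submodule ℝ (Fin N → ℝ) :=
    { carrier := {v | ∃ w, IsTestFunction w ∧ L w = v}
      add_mem' := by
        rintro _ _ ⟨v, hv, rfl⟩ ⟨w, hw, rfl⟩
        exact ⟨v + w, hv.add hw, hadd v w hv hw⟩
      zero_mem' := by
        have h0 : IsTestFunction (0 : ℝ → ℝ) :=
          ⟨contDiff_const, HasCompactSupport.zero, by simp [tsupport]⟩
        refine ⟨(0 : ℝ) • 0, h0.smul 0, ?_⟩
        rw [hsmul 0 0 h0, zero_smul]
      smul_mem' := by
        rintro c _ ⟨w, hw, rfl⟩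
        exact ⟨c • w, hw.smul c, hsmul c w hw⟩ }
  -- A proper subspace of values would lie in the kernel of a nonzero functional, whose coefficients
  -- would be a nontrivial relation.
  have hS : S = ⊤ := by
    by_contra hne
    obtain ⟨f, hf0, hf⟩ := Submodule.exists_le_ker_of_lt_top S (lt_top_iff_ne_top.2 hne)
    apply hf0
    have hα := eigenvalue_functionals_independent hs hd hsd (α := fun l => f (Pi.single l 1))
      (C := C) hinj hlam h1 h2 hen hexp (fun w hw => by
        have h3 : f (L w) = 0 := hf ⟨w, hw, rfl⟩
        rw [LinearMap.pi_apply_eq_sum_univ f (L w)] at h3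
        refine Eq.trans (Finset.sum_congr rfl fun l _ => ?_) h3
        have h4 : (fun j => if l = j then (1 : ℝ) else 0) = Pi.single l 1 := by
          funext j
          simp [Pi.single_apply, eq_comm]
        rw [h4, smul_eq_mul, mul_comm (f _)])
    refine LinearMap.pi_ext' fun l => LinearMap.ext_ring ?_
    exact congrFun hα l
  have hex : ∀ j, ∃ w, IsTestFunction w ∧ L w = Pi.single j 1 := by
    intro j
    have : (Pi.single j 1 : Fin N → ℝ) ∈ S := by rw [hS]; trivial
    exact this
  choose w hw hwL using hex
  exact ⟨w, hw, fun l j => congrFun (hwL j) l⟩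

end Functionals

/-! ### The unperturbed problem in explicit form. -/

section LinearProblem

variable {d : ℝ} [hd : Fact (0 < d)]

theorem phi_psi_const_eq {l : ℝ} {φ ψ : ℝ → ℝ} (h1 : ∀ x, HasDerivAt φ (ψ x) x)
    (h2 : ∀ x, HasDerivAt ψ (-(l * φ x)) x) (h0 : φ 0 = 0) (h0' : ψ 0 = 1)
    (z : Icc (0 : ℝ) d) :
    phi (l • (1 : Cd d)) z = φ z ∧ psi (l • (1 : Cd d)) z = ψ z := by
  have h := eq_smul_phi (q := l • (1 : Cd d)) (f := φ) (v := ψ) (fun z _ =>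
    ⟨(h1 z).hasDerivWithinAt, by
      have : extC (l • (1 : Cd d)) z = l * 1 := rfl
      rw [this, mul_one]
      exact (h2 z).hasDerivWithinAt⟩) h0 z
  rw [h0', one_mul, one_mul] at h
  exact ⟨h.1.symm, h.2.symm⟩

theorem phi_psi_const_sin {s : ℝ} (hs : 0 < s) (z : Icc (0 : ℝ) d) :
    phi ((s ^ 2) • (1 : Cd d)) z = Real.sin (s * z) / s ∧
      psi ((s ^ 2) • (1 : Cd d)) z = Real.cos (s * z) := by
  have hsx : ∀ x : ℝ, HasDerivAt (fun x : ℝ => s * x) s x := fun x => by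
    simpa using (hasDerivAt_id x).const_mul s
  refine phi_psi_const_eq (φ := fun x => Real.sin (s * x) / s) (ψ := fun x => Real.cos (s * x))
    (fun x => ?_) (fun x => ?_) (by simp) (by simp) z
  · exact ((hsx x).sin.div_const s).congr_deriv (by field_simp)
  · refine (hsx x).cos.congr_deriv ?_
    field_simp

/-- The given stream solution agrees with `linStream` on `[0,d]` by uniqueness, and `surfaceSlope`
sees only values there. -/
theorem kappa_linVorticity {b : ℝ} (hβ : phi (b • (1 : Cd d)) (topPt d) ≠ 0) {u : ℝ → ℝ}
    (hu : IsStreamSolution (linVorticity b) d u) :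
    kappa (linVorticity b) d u = linKappa d b := by
  let om : C(ℝ, ℝ) := ⟨linVorticity b, by unfold linVorticity; fun_prop⟩
  have hom : ∀ f : Cd d, om.comp f = b • f + 0 := fun f => by
    rw [add_zero]; rfl
  obtain ⟨U, hU, hU1, a, ha⟩ := IsStreamSolution.exists_integral_eq (om := om) hu
  have hslope := (isStreamSolution_of_integral_eq ha hU1).2
  rw [hom] at ha
  have hlin : U = linStream d b := by
    have := (integral_eq_iff hβ U 0).1 ⟨hU1, a, ha⟩
    rwa [map_zero, add_zero] at this
  have hsl : surfaceSlope d (extC U) = linSlope d b := by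
    rw [hlin] at ha ⊢
    have hval := linStream_integral_eq (d := d) b
    obtain ⟨-, h3⟩ := isStreamSolution_of_integral_eq (om := om)
      (a := (phi (b • (1 : Cd d)) (topPt d))⁻¹) (U := linStream d b)
      (by rw [hom, add_zero]; exact hval) (inv_mul_cancel₀ hβ)
    rw [h3, hom, add_zero]
    have := congrArg (fun f : Cd d => f (topPt d)) (smul_psi_eq (d := d) b)
    simpa [linSlope] using this.symm
  have hcongr : surfaceSlope d u = surfaceSlope d (extC U) := by
    have hdm : d ∈ Icc 0 d := right_mem_Icc.2 hd.out.le
    refine derivWithin_congr (fun z hz => ?_) ?_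
    · rw [extC_mem _ hz]; exact (hU ⟨z, hz⟩).symm
    · rw [extC_mem _ hdm]; exact (hU ⟨d, hdm⟩).symm
  rw [kappa, hcongr, hsl, linKappa, linVorticity, mul_one]

theorem isSLEigenvalue_linVorticity_iff {b : ℝ} (hβ : phi (b • (1 : Cd d)) (topPt d) ≠ 0)
    {u : ℝ → ℝ} (hu : IsStreamSolution (linVorticity b) d u) (μ : ℝ) :
    IsSLEigenvalue (linVorticity b) d u μ ↔ psi ((b + μ) • (1 : Cd d)) (topPt d)
      - linKappa d b * phi ((b + μ) • (1 : Cd d)) (topPt d) = 0 := by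
  rw [← kappa_linVorticity hβ hu]
  refine isSLEigenvalue_iff fun z => ?_
  have : deriv (linVorticity b) (u z) = b := by
    have h : HasDerivAt (linVorticity b) (b * 1) (u z) := (hasDerivAt_id (u z)).const_mul b
    rw [h.deriv, mul_one]
  rw [this]
  simp

end LinearProblem

/-! ### Assembly of the theorem. -/

theorem exists_orderEmb_range_eq {S : Set ℝ} {N : ℕ} (hS : S.encard = N) :
    ∃ m : Fin N → ℝ, StrictMono m ∧ range m = S := by
  have hfin : S.Finite := finite_of_encard_eq_coe hS
  have hcard : hfin.toFinset.card = N := by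
    rw [hfin.encard_eq_coe_toFinset_card] at hS
    exact_mod_cast hS
  exact ⟨hfin.toFinset.orderEmbOfFin hcard, (hfin.toFinset.orderEmbOfFin hcard).strictMono,
    by rw [Finset.range_orderEmbOfFin, hfin.coe_toFinset]⟩

theorem exists_common_lipschitz {N : ℕ} {w : Fin N → ℝ → ℝ} (hw : ∀ k, IsTestFunction (w k)) :
    ∃ C : ℝ, 0 ≤ C ∧ ∀ k x y, |w k x - w k y| ≤ C * |x - y| := by
  have h : ∀ k, ∃ C, LipschitzWith C (w k) := fun k =>
    ContDiff.lipschitzWith_of_hasCompactSupport (hw k).2.1 (hw k).1 (by simp)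
  choose C hC using h
  refine ⟨∑ k, (C k : ℝ), Finset.sum_nonneg fun k _ => (C k).2, fun k x y => ?_⟩
  have h1 := (hC k).dist_le_mul x y
  rw [Real.dist_eq, Real.dist_eq] at h1
  refine h1.trans (mul_le_mul_of_nonneg_right ?_ (abs_nonneg _))
  exact Finset.single_le_sum (f := fun k => (C k : ℝ)) (fun k _ => (C k).2) (Finset.mem_univ k)

/-- A map with diagonal invertible Jacobian matrix is a local diffeomorphism. -/
theorem isLocalDiffeomorphAt_of_diagonal {N : ℕ} {T : (Fin N → ℝ) → Fin N → ℝ} {c : Fin N → ℝ}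
    (hT : ∀ᶠ δ in 𝓝 0, ContDiffAt ℝ ∞ T δ) (hc : ∀ l, c l ≠ 0)
    (hd : ∀ l j, HasDerivAt (fun t : ℝ => T (t • Pi.single j 1) l)
      (c l * (Pi.single j 1 : Fin N → ℝ) l) 0) :
    IsUnit (jacobianMatrix T 0) ∧
      IsLocalDiffeomorphAt 𝓘(ℝ, Fin N → ℝ) 𝓘(ℝ, Fin N → ℝ) ∞ T 0 := by
  have hTd : HasFDerivAt T (fderiv ℝ T 0) 0 :=
    (hT.self_of_nhds.differentiableAt (by simp)).hasFDerivAt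
  have hJ : ∀ l j, fderiv ℝ T 0 (Pi.single j 1) l = c l * (Pi.single j 1 : Fin N → ℝ) l := by
    intro l j
    have hline : HasDerivAt (fun t : ℝ => t • (Pi.single j 1 : Fin N → ℝ)) (Pi.single j 1) 0 := by
      simpa using (hasDerivAt_id (0 : ℝ)).smul_const (Pi.single j 1 : Fin N → ℝ)
    have hTd0 : HasFDerivAt T (fderiv ℝ T 0) ((0 : ℝ) • (Pi.single j 1 : Fin N → ℝ)) := by
      rwa [zero_smul]
    have h1 := hasDerivAt_pi.1 (hTd0.comp_hasDerivAt (0 : ℝ) hline) l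
    exact h1.unique (hd l j)
  have hmat : jacobianMatrix T 0 = Matrix.diagonal c := by
    ext l j
    rw [jacobianMatrix, Matrix.of_apply, hJ, Matrix.diagonal_apply, Pi.single_apply]
    split_ifs <;> simp
  constructor
  · rw [hmat, Matrix.isUnit_iff_isUnit_det, Matrix.det_diagonal, isUnit_iff_ne_zero]
    exact Finset.prod_ne_zero_iff.2 fun l _ => hc l
  · let e : (Fin N → ℝ) ≃L[ℝ] (Fin N → ℝ) :=
      ContinuousLinearEquiv.piCongrRight fun l =>
        ContinuousLinearEquiv.unitsEquivAut ℝ (Units.mk0 (c l) (hc l))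
    have he : (e : (Fin N → ℝ) →L[ℝ] (Fin N → ℝ)) = fderiv ℝ T 0 := by
      refine ContinuousLinearMap.coe_injective (LinearMap.pi_ext' fun j =>
        LinearMap.ext_ring (funext fun l => ?_))
      change (Pi.single j 1 : Fin N → ℝ) l * c l = fderiv ℝ T 0 (Pi.single j 1) l
      rw [hJ, mul_comm]
    exact isLocalDiffeomorphAt_of_hasFDerivAt_equiv hT (f' := e) (by rw [he]; exact hTd)

end

theorem theorem2 (N : ℕ) (hN : 1 ≤ N) (d : ℝ) (hd : 0 < d) (b : ℝ) (hb : 0 < b)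
    (hbd : ∀ j : ℕ, 1 ≤ j → Real.sqrt b ≠ Real.pi * j / (2 * d))
    (u₀ : ℝ → ℝ) (hu₀ : IsStreamSolution (linVorticity b) d u₀)
    (hneg : (negEigenvalues (linVorticity b) d u₀).encard = N)
    (hpos : ∀ μ : ℝ, IsSLEigenvalue (linVorticity b) d u₀ μ →
      μ ∉ negEigenvalues (linVorticity b) d u₀ → 0 < μ) :
    ∃ w : Fin N → ℝ → ℝ, (∀ k, IsTestFunction (w k)) ∧
      ∃ T : (Fin N → ℝ) → Fin N → ℝ,
        IsNegativeSpectrumMap b d w T ∧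
        ContDiffAt ℝ ∞ T 0 ∧
        IsUnit (jacobianMatrix T 0) ∧
        IsLocalDiffeomorphAt 𝓘(ℝ, Fin N → ℝ) 𝓘(ℝ, Fin N → ℝ) ∞ T 0 := by
  have : Fact (0 < d) := ⟨hd⟩
  set s := Real.sqrt b with hs
  have hs0 : 0 < s := Real.sqrt_pos.2 hb
  have hs2 : s ^ 2 = b := Real.sq_sqrt hb.le
  have hpi := Real.pi_pos
  -- The condition on `b` says that `sin (2 s d) ≠ 0`. The sine factor makes the linear problem
  -- uniquely solvable, the cosine factor makes the slope nonzero.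
  have hsincos : Real.sin (s * d) ≠ 0 ∧ Real.cos (s * d) ≠ 0 := by
    rw [← mul_ne_zero_iff]
    intro h0
    have h1 : Real.sin (2 * (s * d)) = 0 := by rw [Real.sin_two_mul]; linarith
    obtain ⟨n, hn⟩ := Real.sin_eq_zero_iff.1 h1
    have hn0 : 0 < n := by
      have : (0 : ℝ) < n * Real.pi := by rw [hn]; positivity
      exact_mod_cast pos_of_mul_pos_left this hpi.le
    apply hbd n.toNat (by omega)
    have hcast : ((n.toNat : ℕ) : ℝ) = (n : ℝ) := by
      exact_mod_cast Int.toNat_of_nonneg hn0.le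
    rw [hcast]
    field_simp
    linarith
  have hsol : ∀ z : Icc (0 : ℝ) d, phi (b • (1 : Cd d)) z = Real.sin (s * z) / s ∧
      psi (b • (1 : Cd d)) z = Real.cos (s * z) := by
    intro z
    rw [← hs2]
    exact phi_psi_const_sin hs0 z
  have hβeq : phi (b • (1 : Cd d)) (topPt d) = Real.sin (s * d) / s := (hsol (topPt d)).1
  have hβ : phi (b • (1 : Cd d)) (topPt d) ≠ 0 := by
    rw [hβeq]
    exact div_ne_zero hsincos.1 hs0.ne'
  have hσ : linSlope d b ≠ 0 := by
    refine mul_ne_zero (inv_ne_zero hβ) ?_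
    rw [(hsol (topPt d)).2]
    exact hsincos.2
  have hstream : ∀ z : Icc (0 : ℝ) d, linStream d b z = Real.sin (s * z) / Real.sin (s * d) := by
    intro z
    change (phi (b • (1 : Cd d)) (topPt d))⁻¹ * phi (b • (1 : Cd d)) z = _
    rw [hβeq, (hsol z).1]
    have := hsincos.1
    field_simp
  obtain ⟨m, hm, hmr⟩ := exists_orderEmb_range_eq hneg
  have hmneg : ∀ l, m l < 0 := fun l => by
    have : m l ∈ negEigenvalues (linVorticity b) d u₀ := hmr ▸ mem_range_self l
    exact this.1
  have hzero : ∀ μ ≤ 0, psi ((b + μ) • (1 : Cd d)) (topPt d)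
      - linKappa d b * phi ((b + μ) • (1 : Cd d)) (topPt d) = 0 ↔ ∃ l, μ = m l := by
    intro μ hμ
    rw [← isSLEigenvalue_linVorticity_iff hβ hu₀]
    constructor
    · intro hev
      have hmem : μ ∈ negEigenvalues (linVorticity b) d u₀ := by
        by_contra hnot
        exact absurd (hpos μ hev hnot) (not_lt.2 hμ)
      rw [← hmr] at hmem
      obtain ⟨l, hl⟩ := hmem
      exact ⟨l, hl.symm⟩
    · rintro ⟨l, rfl⟩
      have : m l ∈ negEigenvalues (linVorticity b) d u₀ := hmr ▸ mem_range_self l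
      exact this.2
  choose φ ψ hφ hψ hφ0 hψ0 hen hexp using fun l : Fin N => exists_linear_solution (b + m l)
  have hphi : ∀ l (z : Icc (0 : ℝ) d), phi ((b + m l) • (1 : Cd d)) z = φ l z := fun l z =>
    (phi_psi_const_eq (hφ l) (hψ l) (hφ0 l) (hψ0 l) z).1
  set c₀ := -2 / linSlope d b ^ 3 + b / linSlope d b ^ 2 with hc₀
  -- Here `c₀` is the derivative of κ with respect to the slope, so `c₀ * φ l d ^ 2` is the weight
  -- of the boundary term in the derivative of the `l`-th eigenvalue.
  obtain ⟨w, hw, hdual⟩ := exists_dual_testFunctions hs0 hd hbd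
    (lam := fun l => b + m l) (C := fun l => c₀ * φ l d ^ 2)
    (fun i j hij => hm.injective (by simpa using hij))
    (fun l => by rw [hs2]; linarith [hmneg l]) hφ hψ hen hexp
  refine ⟨w, hw, ?_⟩
  obtain ⟨C, hC, hL⟩ := exists_common_lipschitz hw
  let W : Fin N → C(ℝ, ℝ) := fun k => ⟨w k, (hw k).1.continuous⟩
  let W' : Fin N → C(ℝ, ℝ) := fun k => ⟨deriv (w k), (hw k).1.continuous_deriv (by simp)⟩
  obtain ⟨T, hTs, hTn, hTd⟩ := exists_spectrumMap (d := d) hβ hσ (W := W) (W' := W')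
    (fun k => (hw k).1) (fun k => (contDiff_infty_iff_deriv.1 (hw k).1).2)
    (fun k x => (((hw k).1.differentiable (by simp)) x).hasDerivAt)
    (fun k => ((hw k).eq_zero (Or.inr le_rfl)).1) hC hL hm hmneg hzero
  have hI : ∀ l, 0 < prim d (phi ((b + m l) • (1 : Cd d)) * phi ((b + m l) • (1 : Cd d)))
      (topPt d) := fun l => prim_phi_mul_phi_pos _
  have hprim : ∀ (f : Cd d) (g : ℝ → ℝ), (∀ z : Icc (0 : ℝ) d, f z = g z) →
      prim d f (topPt d) = ∫ z in (0 : ℝ)..d, g z := by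
    intro f g hfg
    rw [prim_apply]
    refine intervalIntegral.integral_congr fun z hz => ?_
    rw [uIcc_of_le (topPt d).2.1] at hz
    have hz' : z ∈ Icc 0 d := hz
    rw [extC_mem f hz', hfg]
  have hdiag : ∀ l j, HasDerivAt (fun t : ℝ => T (t • Pi.single j 1) l)
      (-1 / prim d (phi ((b + m l) • (1 : Cd d)) * phi ((b + m l) • (1 : Cd d))) (topPt d)
        * (Pi.single j 1 : Fin N → ℝ) l) 0 := by
    intro l j
    refine (hTd l j).congr_deriv ?_
    have e1 := hprim ((W' j).comp (linStream d b) * (phi ((b + m l) • (1 : Cd d))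
        * phi ((b + m l) • (1 : Cd d))))
      (fun z => deriv (w j) (Real.sin (s * z) / Real.sin (s * d)) * φ l z ^ 2) (fun z => by
        change deriv (w j) (linStream d b z) * (phi ((b + m l) • (1 : Cd d)) z
          * phi ((b + m l) • (1 : Cd d)) z) = _
        rw [hstream, hphi]
        ring)
    have e2 := hprim (linStream d b * (W j).comp (linStream d b))
      (fun z => Real.sin (s * z) / Real.sin (s * d) * w j (Real.sin (s * z) / Real.sin (s * d)))
      (fun z => by
        change linStream d b z * w j (linStream d b z) = _
        rw [hstream])
    have e3 : phi ((b + m l) • (1 : Cd d)) (topPt d) = φ l d := hphi l (topPt d)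
    rw [e1, e2, e3, ← hdual l j]
    ring
  obtain ⟨h1, h2⟩ := isLocalDiffeomorphAt_of_diagonal hTs
    (fun l => div_ne_zero (by norm_num) (hI l).ne') hdiag
  exact ⟨T, hTn, hTs.self_of_nhds, h1, h2⟩
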